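/- Let $N\ge 1$ be an integer, let $I\subset\mathbb R$ be a bounded interval, and let $\alpha>0$, with moreover $\alpha\le \frac{4}{N-2}$ if $N\ge 3$. All functions are complex valued, $H^1=H^1(\mathbb R^N)$ is the Sobolev space of $f\in L^2(\mathbb R^N)$ with weak gradient in $L^2(\mathbb R^N)$, $H^{-1}$ is its dual, $\Delta:H^1\to H^{-1}$ is the Laplacian, and $g_\alpha(z)=|z|^\alpha z$ for $z\in\mathbb C$. For $X=H^1,\ H^{-1},\ L^{\frac{\alpha+2}{\alpha+1}}(\mathbb R^N)$, weak-$*$ convergence in $L^\infty(I;X)$ means convergence of the dual pairings with every element of $L^1(I;Y)$, where $Y=H^{-1},\ H^1,\ L^{\alpha+2}(\mathbb R^N)$ respectively. Suppose that $(u_n)_{n\in\mathbb N}\subset L^\infty(I;H^1)$ and $u\in L^\infty(I;L^2(\mathbb R^N))$ satisfy $$\sup_{n}\|u_n\|_{L^\infty(I;H^1)}<\infty,\qquad \lim_{n\to\infty}\|u_n-u\|_{L^\infty(I;L^2)}=0 .$$ Then $u\in L^\infty(I;H^1)$, the functions $g_\alpha(u_n)$ and $g_\alpha(u)$ belong to $L^\infty(I;L^{\frac{\alpha+2}{\alpha+1}}(\mathbb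 R^N))$, and, for the whole sequence, $$u_n\rightharpoonup u \ \text{ weak-}*\text{ in } L^\infty(I;H^1),\qquad \Delta u_n\rightharpoonup \Delta u\ \text{ weak-}*\text{ in } L^\infty(I;H^{-1}),$$ $$g_\alpha(u_n)\rightharpoonup g_\alpha(u)\ \text{ weak-}*\text{ in } L^\infty(I;L^{\frac{\alpha+2}{\alpha+1}}(\mathbb R^N)).$$ If moreover $u_n\in W^{1,\infty}(I;H^{-1})$ for all $n$ and $\sup_n\|u_n\|_{W^{1,\infty}(I;H^{-1})}<\infty$, where $\|v\|_{W^{1,\infty}(I;H^{-1})}=\|v\|_{L^\infty(I;H^{-1})}+\|\partial_t v\|_{L^\infty(I;H^{-1})}$ and $\partial_t$ is the distributional derivative on the interior of $I$, then $u\in W^{1,\infty}(I;H^{-1})$ and $$\partial_t u_n\rightharpoonup \partial_t u\ \text{ weak-}*\text{ in } L^\infty(I;H^{-1}).$$ -/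

import Mathlib

open MeasureTheory Filter Topology
open scoped ENNReal SchwartzMap ContDiff

noncomputable section

namespace NLS

/-- The space `ℝ^N` with its Euclidean norm. -/
abbrev Sp (N : ℕ) : Type := EuclideanSpace ℝ (Fin N)

/-- The complex Lebesgue space `L^p(ℝ^N)`. -/
abbrev LSp (N : ℕ) (p : ℝ≥0∞) : Type := Lp ℂ p (volume : Measure (Sp N))

/-- The Sobolev space `H¹(ℝ^N)` of complex functions: `f ∈ L²` with distributional gradient
`(g₁, …, g_N)` in `L²`. An element is stored as the pair `(f, (g_j)_j)`, the gradient being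
determined by `f`; the norm inherited from the ambient space is
`(‖f‖² + ∑ j, ‖∂_j f‖²)^(1/2)` with `L²` norms. -/
def H1 (N : ℕ) : Submodule ℂ (WithLp 2 (LSp N 2 × PiLp 2 (fun _ : Fin N => LSp N 2))) where
  carrier := {f | ∀ j : Fin N,
    LineDeriv.lineDerivOp (EuclideanSpace.single j (1 : ℝ))
      (Lp.toTemperedDistribution f.fst : 𝓢'(Sp N, ℂ)) = Lp.toTemperedDistribution (f.snd j)}
  add_mem' := by
    intro a b ha hb j
    have h1 := ha j
    have h2 := hb j
    simp only [← Lp.toTemperedDistributionCLM_apply] at h1 h2 ⊢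
    rw [WithLp.add_fst, WithLp.add_snd, PiLp.add_apply, map_add, map_add,
      LineDeriv.lineDerivOp_add, h1, h2]
  zero_mem' := by
    intro j
    simp only [← Lp.toTemperedDistributionCLM_apply]
    rw [WithLp.zero_fst, WithLp.zero_snd, PiLp.zero_apply, map_zero, LineDeriv.lineDerivOp_zero]
  smul_mem' := by
    intro c a ha j
    have h1 := ha j
    simp only [← Lp.toTemperedDistributionCLM_apply] at h1 ⊢
    rw [WithLp.smul_fst, WithLp.smul_snd, PiLp.smul_apply, map_smul, map_smul,
      LineDeriv.lineDerivOp_smul, h1]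

/-- The space `H⁻¹(ℝ^N)`, the topological dual of `H¹(ℝ^N)`, with the dual norm. Dualities are
taken bilinear (without complex conjugation), as for distributions. -/
abbrev Hm1 (N : ℕ) : Type := H1 N →L[ℂ] ℂ

/-- The inclusion `H¹(ℝ^N) ⊆ L²(ℝ^N)`. -/
def H1.toL2 (N : ℕ) : H1 N →L[ℂ] LSp N 2 :=
  (WithLp.fstL 2 ℂ (LSp N 2) (PiLp 2 (fun _ : Fin N => LSp N 2))) ∘L (H1 N).subtypeL

/-- The partial derivative `∂_j : H¹(ℝ^N) → L²(ℝ^N)`. -/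
def H1.partialDeriv (N : ℕ) (j : Fin N) : H1 N →L[ℂ] LSp N 2 :=
  (PiLp.proj 2 (𝕜 := ℂ) (fun _ : Fin N => LSp N 2) j) ∘L
    (WithLp.sndL 2 ℂ (LSp N 2) (PiLp 2 (fun _ : Fin N => LSp N 2))) ∘L (H1 N).subtypeL

/-- The bilinear pairing `(f, g) ↦ ∫ f(x) g(x) dx` of `L^p(ℝ^N)` with `L^q(ℝ^N)` for conjugate
exponents. -/
def lpDuality (N : ℕ) (p q : ℝ≥0∞) [Fact (1 ≤ p)] [Fact (1 ≤ q)] [p.HolderConjugate q] :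
    LSp N p →L[ℂ] LSp N q →L[ℂ] ℂ :=
  (ContinuousLinearMap.mul ℂ ℂ).lpPairing volume p q

/-- The inclusion `L²(ℝ^N) ⊆ H⁻¹(ℝ^N)`, `⟨f, φ⟩ = ∫ f φ`. -/
def L2toHm1 (N : ℕ) : LSp N 2 →L[ℂ] Hm1 N :=
  (lpDuality N 2 2).bilinearComp (ContinuousLinearMap.id ℂ _) (H1.toL2 N)

/-- The Laplacian `Δ : H¹(ℝ^N) → H⁻¹(ℝ^N)`, `⟨Δ u, φ⟩ = - ∑ j, ∫ ∂_j u ∂_j φ`. -/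
def laplacian (N : ℕ) : H1 N →L[ℂ] Hm1 N :=
  -∑ j : Fin N, (lpDuality N 2 2).bilinearComp (H1.partialDeriv N j) (H1.partialDeriv N j)

section Bochner

variable {X Y : Type*} [NormedAddCommGroup X] [NormedSpace ℂ X]
  [NormedAddCommGroup Y] [NormedSpace ℂ Y]

/-- The Bochner space `L^∞(I; X)`. -/
abbrev LInfty (I : Set ℝ) (X : Type*) [NormedAddCommGroup X] : Type _ :=
  Lp X ∞ ((volume : Measure ℝ).restrict I)

/-- The Bochner space `L¹(I; X)`. -/
abbrev LOne (I : Set ℝ) (X : Type*) [NormedAddCommGroup X] : Type _ :=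
  Lp X 1 ((volume : Measure ℝ).restrict I)

/-- The pointwise action `(L u)(t) = L (u(t))` of a bounded operator on `L^∞(I; X)`. -/
def LInfty.map (I : Set ℝ) (L : X →L[ℂ] Y) (u : LInfty I X) : LInfty I Y := L.compLp u

/-- Weak-* convergence in `L^∞(I; X)`, where `X` is the dual of `Y` through the pairing `B`:
`∫_I ⟨u_n(t), φ(t)⟩ dt → ∫_I ⟨u(t), φ(t)⟩ dt` for every `φ ∈ L¹(I; Y)`. -/
def WeakStarTendsto (I : Set ℝ) (B : X →L[ℂ] Y →L[ℂ] ℂ) (u : ℕ → LInfty I X)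
    (v : LInfty I X) : Prop :=
  ∀ φ : LOne I Y, Tendsto (fun n => ∫ t in I, B (u n t) (φ t)) atTop
    (𝓝 (∫ t in I, B (v t) (φ t)))

/-- `w = ∂_t u` in the sense of `X`-valued distributions on (the interior of) `I`. Thus
`u ∈ W^{1,∞}(I; X)` means that such a `w ∈ L^∞(I; X)` exists, and then
`‖u‖_{W^{1,∞}(I; X)} = ‖u‖_{L^∞(I; X)} + ‖w‖_{L^∞(I; X)}`. -/
def IsTimeDeriv (I : Set ℝ) (u w : LInfty I X) : Prop :=
  ∀ φ : ℝ → ℂ, ContDiff ℝ ∞ φ → HasCompactSupport φ → tsupport φ ⊆ interior I →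
    ∫ t in I, deriv φ t • u t = -∫ t in I, φ t • w t

end Bochner

/-- The inclusion `L^∞(I; L²(ℝ^N)) ⊆ L^∞(I; H⁻¹(ℝ^N))`. -/
def LInfty.toHm1 {N : ℕ} (I : Set ℝ) (u : LInfty I (LSp N 2)) : LInfty I (Hm1 N) :=
  LInfty.map (Y := Hm1 N) I (L2toHm1 N) u

/-- `Δ u ∈ L^∞(I; H⁻¹(ℝ^N))` for `u ∈ L^∞(I; H¹(ℝ^N))`. -/
def LInfty.laplacian {N : ℕ} (I : Set ℝ) (u : LInfty I (H1 N)) : LInfty I (Hm1 N) :=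
  LInfty.map (Y := Hm1 N) I (NLS.laplacian N) u

/-- `u ∈ L^∞(I; H¹(ℝ^N))` seen as an element of `L^∞(I; L²(ℝ^N))`. -/
def LInfty.toL2 {N : ℕ} (I : Set ℝ) (u : LInfty I (H1 N)) : LInfty I (LSp N 2) :=
  LInfty.map (Y := LSp N 2) I (H1.toL2 N) u

/-- The pairing of `H¹` with its predual `H⁻¹`, `(f, ℓ) ↦ ℓ f`. -/
def pairH1 (N : ℕ) : H1 N →L[ℂ] Hm1 N →L[ℂ] ℂ := ContinuousLinearMap.apply ℂ ℂ

/-- The pairing of `H⁻¹` with `H¹`, `(ℓ, f) ↦ ℓ f`. -/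
def pairHm1 (N : ℕ) : Hm1 N →L[ℂ] H1 N →L[ℂ] ℂ := ContinuousLinearMap.id ℂ (Hm1 N)

/-- The exponent `α + 2`. -/
def expP (α : ℝ) : ℝ≥0∞ := ENNReal.ofReal (α + 2)

/-- The exponent `(α + 2) / (α + 1)`, conjugate to `α + 2`. -/
def expQ (α : ℝ) : ℝ≥0∞ := ENNReal.ofReal ((α + 2) / (α + 1))

instance expP_one_le (α : ℝ) [hα : Fact (0 < α)] : Fact (1 ≤ expP α) :=
  ⟨by
    have := hα.out
    rw [expP, ENNReal.one_le_ofReal]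
    linarith⟩

instance expQ_one_le (α : ℝ) [hα : Fact (0 < α)] : Fact (1 ≤ expQ α) :=
  ⟨by
    have := hα.out
    rw [expQ, ENNReal.one_le_ofReal, one_le_div (by linarith)]
    linarith⟩

instance exp_conj (α : ℝ) [hα : Fact (0 < α)] : (expQ α).HolderConjugate (expP α) := by
  have := hα.out
  have h : ((α + 2) / (α + 1)).HolderConjugate (α + 2) := by
    rw [Real.holderConjugate_iff]
    refine ⟨by rw [one_lt_div (by linarith)]; linarith, ?_⟩
    field_simp
    ring
  exact h.ennrealOfReal

/-- The nonlinearity `g_α(z) = |z|^α z`. -/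
def nonlin (α : ℝ) (z : ℂ) : ℂ := ((‖z‖ ^ α : ℝ) : ℂ) * z

/-- The element `G` of `L^∞(I; L^{(α+2)/(α+1)}(ℝ^N))` is the function `g_α(u)`: for almost every
time `t`, `G(t)(x) = |u(t,x)|^α u(t,x)` for almost every `x`. -/
def IsNonlin {N : ℕ} (I : Set ℝ) (α : ℝ) [Fact (0 < α)] (u : LInfty I (LSp N 2))
    (G : LInfty I (LSp N (expQ α))) : Prop :=
  ∀ᵐ t ∂((volume : Measure ℝ).restrict I), ∀ᵐ x : Sp N, (G t) x = nonlin α ((u t) x)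

end NLS

end

/-!
All limits are identified from the norm convergence in `L^∞(I; L²)`; the bounds supply the spaces.

**Weak-star convergence in `L^∞(I; X)` for a Hilbert space `X`.** On a bounded interval, a bounded
sequence of `L^∞(I; X)` is bounded in the Hilbert space `L²(I; X)`. If its inner products with the
elements of a total set converge, then all its inner products converge, and the Riesz theorem turns
the limit functional into an element of `L²(I; X)`. This element has values in the same ball, hence
lies in `L^∞(I; X)`, and density of `L²` in `L¹` gives convergence against all of `L¹(I; X)`
(`exists_weakStar_limit`). No subsequence is extracted and no separability is needed, so the whole
sequence converges. For `u_n` the total set is the range of the adjoint of the injection `H¹ ⊆ L²`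
(`exists_weakStar_lift`). For `∂_t u_n`, which takes values in a dual of a Hilbert space, it
consists of the products `η(t) e` with a test function `η` and a vector `e`; the derivative can be
moved onto `η` (`exists_timeDeriv_limit`). The statement for `Δ u_n` follows from that for `u_n`
because the bilinear form of the Laplacian is symmetric (`weakStarTendsto_map_of_symm`).

**The nonlinearity.** For `α ≤ 4 / (N - 2)` there is a Sobolev embedding `H¹ ⊆ L^(α+2)`
(`SobolevBound.exists_embedding`), so `g_α(u_n)` is bounded in `L^∞(I; L^((α+2)/(α+1)))`. For almost
every `t` the sequence `u_n(t)` converges in `L²`, so every subsequence has a further subsequence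
along which it converges almost everywhere on `ℝ^N`. A sequence that is bounded in `L^q`, `q > 1`,
and converges almost everywhere converges weakly (`tendsto_lintegral_mul_zero_of_ae`). Hence
`g_α(u_n(t))` converges weakly to `g_α(u(t))` for almost every `t`, and dominated convergence in `t`
concludes (`weakStarTendsto_nonlinLInfty`). This covers the critical exponent, where the convergence
of `u_n` in `L^(α+2)` may fail.

**The Sobolev embedding.** On compactly supported `C¹` functions the inequality is elementary in
dimension one, and comes from the Gagliardo–Nirenberg–Sobolev inequality in higher dimensions,
applied to powers of the function in dimension two. It passes to Schwartz functions by cut-offs, and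
from them to `H¹` by density: an element of `H¹` orthogonal to all Schwartz functions solves
`f - Δ f = 0` in the sense of tempered distributions, and therefore vanishes.
-/

namespace NLS

variable {N : ℕ}

/-! ### The Hilbert space `H¹` and the density of Schwartz functions -/

theorem isClosed_H1 (N : ℕ) :
    IsClosed (H1 N : Set (WithLp 2 (LSp N 2 × PiLp 2 (fun _ : Fin N => LSp N 2)))) := by
  have : (H1 N : Set (WithLp 2 (LSp N 2 × PiLp 2 (fun _ : Fin N => LSp N 2)))) =
      ⋂ j : Fin N, {f | LineDeriv.lineDerivOpCLM ℂ 𝓢'(Sp N, ℂ) (EuclideanSpace.single j (1 : ℝ))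
        (Lp.toTemperedDistributionCLM ℂ volume 2 f.fst) =
        Lp.toTemperedDistributionCLM ℂ volume 2 (f.snd j)} := by
    ext f
    simp only [Set.mem_iInter, Set.mem_ofPred_eq]
    rfl
  rw [this]
  refine isClosed_iInter fun j => isClosed_eq ?_ ?_
  · exact (LineDeriv.lineDerivOpCLM ℂ 𝓢'(Sp N, ℂ) _).continuous.comp
      ((Lp.toTemperedDistributionCLM ℂ volume 2).continuous.comp
        (WithLp.fstL 2 ℂ (LSp N 2) (PiLp 2 (fun _ : Fin N => LSp N 2))).continuous)
  · exact (Lp.toTemperedDistributionCLM ℂ volume 2).continuous.comp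
      ((PiLp.proj 2 (𝕜 := ℂ) (fun _ : Fin N => LSp N 2) j).continuous.comp
        (WithLp.sndL 2 ℂ (LSp N 2) (PiLp 2 (fun _ : Fin N => LSp N 2))).continuous)

instance completeSpace_H1 : CompleteSpace (H1 N) := (isClosed_H1 N).completeSpace_coe

theorem toTemperedDistribution_injective {p : ℝ≥0∞} [Fact (1 ≤ p)] :
    Function.Injective (Lp.toTemperedDistributionCLM ℂ (volume : Measure (Sp N)) p) :=
  LinearMap.ker_eq_bot.mp Lp.ker_toTemperedDistributionCLM_eq_bot

theorem H1.lineDeriv_toL2 (f : H1 N) (j : Fin N) :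
    LineDeriv.lineDerivOpCLM ℂ 𝓢'(Sp N, ℂ) (EuclideanSpace.single j (1 : ℝ))
      (Lp.toTemperedDistributionCLM ℂ volume 2 (H1.toL2 N f)) =
      Lp.toTemperedDistributionCLM ℂ volume 2 (H1.partialDeriv N j f) := f.2 j

theorem H1.ext {f g : H1 N} (h0 : H1.toL2 N f = H1.toL2 N g)
    (h1 : ∀ j, H1.partialDeriv N j f = H1.partialDeriv N j g) : f = g := by
  apply Subtype.ext
  apply WithLp.ofLp_injective
  refine Prod.ext h0 ?_
  exact PiLp.ext h1

/-- The gradient component of an element of `H¹` is determined by the function. -/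
theorem H1.toL2_injective : Function.Injective (H1.toL2 N) := by
  intro f g h
  refine H1.ext h fun j => toTemperedDistribution_injective ?_
  rw [← H1.lineDeriv_toL2, ← H1.lineDeriv_toL2, h]

theorem H1.inner_eq (f g : H1 N) :
    inner ℂ f g = inner ℂ (H1.toL2 N f) (H1.toL2 N g) +
      ∑ j, inner ℂ (H1.partialDeriv N j f) (H1.partialDeriv N j g) := by
  rw [Submodule.coe_inner, WithLp.prod_inner_apply, PiLp.inner_apply]
  rfl

theorem H1.mk_mem {f : LSp N 2} {g : Fin N → LSp N 2}
    (h : ∀ j, LineDeriv.lineDerivOp (EuclideanSpace.single j (1 : ℝ))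
      (Lp.toTemperedDistribution f : 𝓢'(Sp N, ℂ)) = Lp.toTemperedDistribution (g j)) :
    WithLp.toLp 2 (f, WithLp.toLp 2 g) ∈ H1 N := h

/-- Schwartz functions as elements of `H¹`. -/
noncomputable def H1.ofSchwartz (φ : 𝓢(Sp N, ℂ)) : H1 N :=
  ⟨_, H1.mk_mem (f := φ.toLp 2) (g := fun j =>
      (LineDeriv.lineDerivOp (EuclideanSpace.single j (1 : ℝ)) φ : 𝓢(Sp N, ℂ)).toLp 2) fun j => by
    rw [Lp.toTemperedDistribution_toLp_eq, Lp.toTemperedDistribution_toLp_eq]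
    exact TemperedDistribution.lineDerivOp_toTemperedDistributionCLM_eq φ _⟩

theorem H1.toL2_ofSchwartz (φ : 𝓢(Sp N, ℂ)) : H1.toL2 N (H1.ofSchwartz φ) = φ.toLp 2 := rfl

theorem H1.partialDeriv_ofSchwartz (φ : 𝓢(Sp N, ℂ)) (j : Fin N) :
    H1.partialDeriv N j (H1.ofSchwartz φ) =
      (LineDeriv.lineDerivOp (EuclideanSpace.single j (1 : ℝ)) φ : 𝓢(Sp N, ℂ)).toLp 2 := rfl

/-- The operator `1 - Δ` is injective on tempered distributions: its symbol `1 + 4π²|ξ|²` has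
an inverse of temperate growth. -/
theorem eq_zero_of_eq_laplacian (T : 𝓢'(Sp N, ℂ)) (h : T = Laplacian.laplacian T) : T = 0 := by
  -- `a` is the inverse of the symbol `∑ i, b i = 1 + ‖2πx‖²` of `1 - Δ`
  let a : Sp N → ℂ := fun x => (((1 + ‖(2 * Real.pi) • x‖ ^ 2) ^ (-1 : ℝ) : ℝ) : ℂ)
  let b : Fin 2 → Sp N → ℂ :=
    ![fun _ => 1, (((2 * Real.pi) ^ 2 : ℝ) : ℂ) • fun x : Sp N => ((‖x‖ ^ 2 : ℝ) : ℂ)]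
  have hsq : (fun x : Sp N => ((‖x‖ ^ 2 : ℝ) : ℂ)).HasTemperateGrowth := by fun_prop
  have hb : ∀ i ∈ Finset.univ, (b i).HasTemperateGrowth := by
    intro i _
    fin_cases i
    · change Function.HasTemperateGrowth (fun _ : Sp N => (1 : ℂ))
      fun_prop
    · change Function.HasTemperateGrowth
        (fun x : Sp N => (((2 * Real.pi) ^ 2 : ℝ) : ℂ) * ((‖x‖ ^ 2 : ℝ) : ℂ))
      exact Function.HasTemperateGrowth.mul (.const _) hsq
  have ha : a.HasTemperateGrowth := by
    have h1 : (fun x : Sp N => (((1 + ‖x‖ ^ 2) ^ (-1 : ℝ) : ℝ) : ℂ)).HasTemperateGrowth := by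
      fun_prop
    have h2 : (fun x : Sp N => (2 * Real.pi) • x).HasTemperateGrowth :=
      ((2 * Real.pi) • ContinuousLinearMap.id ℝ (Sp N)).hasTemperateGrowth
    exact Function.HasTemperateGrowth.comp h1 h2
  have h0 : TemperedDistribution.fourierMultiplierCLM ℂ (fun x => ∑ i, b i x) T = 0 := by
    rw [TemperedDistribution.fourierMultiplierCLM_sum ℂ hb, Fin.sum_univ_two]
    have e0 : b 0 = fun _ => 1 := rfl
    have e1 : b 1 = (((2 * Real.pi) ^ 2 : ℝ) : ℂ) • fun x : Sp N => ((‖x‖ ^ 2 : ℝ) : ℂ) := rfl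
    rw [e0, e1]
    rw [TemperedDistribution.fourierMultiplierCLM_smul hsq,
      TemperedDistribution.fourierMultiplierCLM_const]
    have h' := TemperedDistribution.laplacian_eq_fourierMultiplierCLM T
    rw [← h] at h'
    simp only [one_smul, add_apply, smul_apply,
      ContinuousLinearMap.id_apply]
    nth_rewrite 1 [h']
    rw [neg_smul, neg_add_eq_zero]
    ext u
    simp
  have hab := TemperedDistribution.fourierMultiplierCLM_fourierMultiplierCLM_apply
    (g₁ := fun x => ∑ i, b i x) (F := ℂ) (Function.HasTemperateGrowth.sum hb) ha T
  have e : (fun x => ∑ i, b i x) * a = fun _ => 1 := by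
    ext x
    have : (∑ i, b i x) = ((1 + ‖(2 * Real.pi) • x‖ ^ 2 : ℝ) : ℂ) := by
      rw [Fin.sum_univ_two, norm_smul, mul_pow, Real.norm_eq_abs, sq_abs]
      simp [b]
    simp only [Pi.mul_apply, this, a]
    rw [← Complex.ofReal_mul, Real.rpow_neg_one, mul_inv_cancel₀ (by positivity)]
    simp
  rw [h0, map_zero, e] at hab
  simpa using hab.symm

/-- The complex conjugate of a Schwartz function. -/
noncomputable def conjSchwartz (φ : 𝓢(Sp N, ℂ)) : 𝓢(Sp N, ℂ) :=
  SchwartzMap.postcompCLM (𝕜 := ℝ) (Complex.conjCLE : ℂ →L[ℝ] ℂ) φ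

theorem conjSchwartz_apply (φ : 𝓢(Sp N, ℂ)) (x : Sp N) :
    conjSchwartz φ x = starRingEnd ℂ (φ x) := rfl

theorem lineDerivOp_conjSchwartz (φ : 𝓢(Sp N, ℂ)) (m : Sp N) :
    LineDeriv.lineDerivOp m (conjSchwartz φ) = conjSchwartz (LineDeriv.lineDerivOp m φ) := by
  ext x
  rw [conjSchwartz_apply, SchwartzMap.lineDerivOp_apply_eq_fderiv,
    SchwartzMap.lineDerivOp_apply_eq_fderiv]
  have h := (Complex.conjCLE : ℂ →L[ℝ] ℂ).hasFDerivAt.comp x (φ.hasFDerivAt x)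
  have h' : HasFDerivAt (conjSchwartz φ) _ x := h
  rw [h'.fderiv]
  rfl

theorem inner_toLp_conjSchwartz (φ : 𝓢(Sp N, ℂ)) (f : LSp N 2) :
    inner ℂ ((conjSchwartz φ).toLp 2 : LSp N 2) f =
      Lp.toTemperedDistributionCLM ℂ volume 2 f φ := by
  rw [Lp.toTemperedDistributionCLM_apply, Lp.toTemperedDistribution_apply, L2.inner_def]
  refine integral_congr_ae ?_
  filter_upwards [(conjSchwartz φ).coeFn_toLp 2] with x hx
  rw [hx, conjSchwartz_apply, RCLike.inner_apply, starRingEnd_self_apply, smul_eq_mul, mul_comm]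

/-- A linear map into a Hilbert space has dense range if nothing but `0` is orthogonal to it. The
map is unbundled so that Schwartz functions need no bundled linear map into `H¹`. -/
theorem denseRange_of_forall_inner_eq_zero {V X : Type*} [AddCommGroup V] [Module ℂ V]
    [NormedAddCommGroup X] [InnerProductSpace ℂ X] [CompleteSpace X] (ι : V → X)
    (hadd : ∀ v w, ι (v + w) = ι v + ι w) (hsmul : ∀ (c : ℂ) v, ι (c • v) = c • ι v)
    (h : ∀ x, (∀ v, inner ℂ (ι v) x = 0) → x = 0) : DenseRange ι := by
  let L : V →ₗ[ℂ] X := ⟨⟨ι, hadd⟩, hsmul⟩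
  have : Dense (LinearMap.range L : Set X) := by
    rw [Submodule.dense_iff_topologicalClosure_eq_top, Submodule.topologicalClosure_eq_top_iff,
      Submodule.eq_bot_iff]
    exact fun x hx => h x fun v => hx _ ⟨v, rfl⟩
  rwa [LinearMap.coe_range] at this

/-- Schwartz functions are dense in `H¹`: an element of `H¹` orthogonal to all of them solves
`f - Δf = 0`. -/
theorem H1.denseRange_ofSchwartz : DenseRange (H1.ofSchwartz (N := N)) := by
  refine denseRange_of_forall_inner_eq_zero _ (fun φ ψ => H1.toL2_injective ?_)
    (fun c φ => H1.toL2_injective ?_) fun f hf => ?_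
  · rw [(H1.toL2 N).map_add]
    exact map_add (SchwartzMap.toLpCLM ℂ ℂ 2 (volume : Measure (Sp N))) φ ψ
  · rw [(H1.toL2 N).map_smul]
    exact map_smul (SchwartzMap.toLpCLM ℂ ℂ 2 (volume : Measure (Sp N))) c φ
  apply H1.toL2_injective
  apply toTemperedDistribution_injective
  rw [map_zero, map_zero]
  apply eq_zero_of_eq_laplacian
  rw [TemperedDistribution.laplacian_eq_sum (EuclideanSpace.basisFun (Fin N) ℝ)]
  ext φ
  have h1 : inner ℂ (H1.ofSchwartz (conjSchwartz φ)) f = 0 := hf (conjSchwartz φ)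
  rw [H1.inner_eq, H1.toL2_ofSchwartz, inner_toLp_conjSchwartz] at h1
  rw [sum_apply, eq_neg_of_add_eq_zero_left h1, ← Finset.sum_neg_distrib]
  refine Finset.sum_congr rfl fun j _ => ?_
  rw [H1.partialDeriv_ofSchwartz, lineDerivOp_conjSchwartz, inner_toLp_conjSchwartz,
    EuclideanSpace.basisFun_apply, TemperedDistribution.lineDerivOp_apply_apply, map_neg,
    ← H1.lineDeriv_toL2]
  rfl

/-! ### The Sobolev inequality for compactly supported functions -/

/-- The Sobolev inequality for the exponent `p` on compactly supported `C¹` functions, in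
normalised form: the functions with `‖φ‖₂ ≤ 1` and `‖∇φ‖₂ ≤ 1` are bounded in `L^p(ℝ^N)`. -/
def SobolevBound (N : ℕ) (p : ℝ) : Prop :=
  ∃ K : NNReal, ∀ φ : Sp N → ℂ, ContDiff ℝ 1 φ → HasCompactSupport φ →
    ∫⁻ x, ‖φ x‖ₑ ^ (2 : ℝ) ≤ 1 → ∫⁻ x, ‖fderiv ℝ φ x‖ₑ ^ (2 : ℝ) ≤ 1 → ∫⁻ x, ‖φ x‖ₑ ^ p ≤ K

theorem SobolevBound.two (N : ℕ) : SobolevBound N 2 := ⟨1, fun _ _ _ h _ => by simpa using h⟩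

/-- Interpolation with the trivial exponent `2`, through `s^p ≤ s² + s^r` for `2 ≤ p ≤ r`. -/
theorem SobolevBound.of_le {p r : ℝ} (h : SobolevBound N r) (hp : 2 ≤ p) (hr : p ≤ r) :
    SobolevBound N p := by
  obtain ⟨K, hK⟩ := h
  refine ⟨1 + K, fun φ h1 h2 h3 h4 => ?_⟩
  calc ∫⁻ x, ‖φ x‖ₑ ^ p ≤ ∫⁻ x, (‖φ x‖ₑ ^ (2 : ℝ) + ‖φ x‖ₑ ^ r) := by
        refine lintegral_mono fun x => ?_
        rcases le_total ‖φ x‖ₑ 1 with hx | hx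
        · exact (ENNReal.rpow_le_rpow_of_exponent_ge hx hp).trans le_self_add
        · exact (ENNReal.rpow_le_rpow_of_exponent_le hx hr).trans le_add_self
    _ = (∫⁻ x, ‖φ x‖ₑ ^ (2 : ℝ)) + ∫⁻ x, ‖φ x‖ₑ ^ r := by
        rw [lintegral_add_left]
        exact (h1.continuous.enorm.measurable.pow_const _)
    _ ≤ 1 + K := add_le_add h3 (hK φ h1 h2 h3 h4)
    _ = ((1 + K : NNReal) : ℝ≥0∞) := by simp

theorem lintegral_mul_le_sqrt_mul_sqrt {f g : Sp N → ℝ≥0∞} (hf : Measurable f)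
    (hg : Measurable g) {A B : ℝ≥0∞} (hA : ∫⁻ x, f x ^ (2 : ℝ) ≤ A)
    (hB : ∫⁻ x, g x ^ (2 : ℝ) ≤ B) :
    ∫⁻ x, f x * g x ≤ A ^ (1 / 2 : ℝ) * B ^ (1 / 2 : ℝ) := by
  refine (ENNReal.lintegral_mul_le_Lp_mul_Lq volume Real.HolderConjugate.two_two
    hf.aemeasurable hg.aemeasurable).trans ?_
  gcongr

theorem enorm_fderiv_pow_le {φ : Sp N → ℂ} (h : ContDiff ℝ 1 φ) (m : ℕ) (x : Sp N) :
    ‖fderiv ℝ (fun y => φ y ^ (m + 1)) x‖ₑ ≤ (m + 1 : ℕ) * (‖φ x‖ₑ ^ m * ‖fderiv ℝ φ x‖ₑ) := by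
  have h1 : fderiv ℝ (fun y => φ y ^ (m + 1)) x = ((m + 1 : ℕ) * φ x ^ m) • fderiv ℝ φ x := by
    have h2 : HasFDerivAt φ (fderiv ℝ φ x) x := (h.differentiable one_ne_zero x).hasFDerivAt
    refine (h2.pow (m + 1)).fderiv.trans ?_
    rw [nsmul_eq_mul, Nat.add_sub_cancel]
  rw [h1, enorm_smul, enorm_mul, enorm_pow, mul_assoc]
  have h2 : ‖((m + 1 : ℕ) : ℂ)‖ₑ = (m + 1 : ℕ) := by
    rw [enorm_eq_nnnorm, Complex.nnnorm_natCast]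
    simp
  rw [h2]

/-- In dimension two the `L¹` Gagliardo–Nirenberg–Sobolev inequality applied to `φ ^ (m + 1)`
raises the exponent from `2m` to `2(m + 1)`. -/
theorem SobolevBound.dim_two_step {m : ℕ} (h : SobolevBound 2 (2 * m)) :
    SobolevBound 2 (2 * (m + 1 : ℕ)) := by
  obtain ⟨K, hK⟩ := h
  let C := lintegralPowLePowLIntegralFDerivConst (volume : Measure (Sp 2)) 2
  refine ⟨C * ((m + 1 : ℕ) * K ^ (1 / 2 : ℝ)) ^ (2 : ℝ), fun φ h1 h2 h3 h4 => ?_⟩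
  have hfin : ((Module.finrank ℝ (Sp 2) : ℕ) : ℝ).HolderConjugate 2 := by
    rw [finrank_euclideanSpace_fin]
    exact_mod_cast Real.HolderConjugate.two_two
  have hG := lintegral_pow_le_pow_lintegral_fderiv (volume : Measure (Sp 2))
    (u := fun y => φ y ^ (m + 1)) (h1.pow _)
    (h2.comp_left (g := fun z : ℂ => z ^ (m + 1)) (by simp)) hfin
  have hm : Measurable fun x => ‖φ x‖ₑ := h1.continuous.enorm.measurable
  have hm' : Measurable fun x => ‖fderiv ℝ φ x‖ₑ :=
    (h1.continuous_fderiv one_ne_zero).enorm.measurable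
  have hpow : ∀ k : ℕ, ∀ x, (‖φ x‖ₑ ^ k) ^ (2 : ℝ) = ‖φ x‖ₑ ^ (2 * k : ℝ) := by
    intro k x
    rw [← ENNReal.rpow_natCast, ← ENNReal.rpow_mul, mul_comm]
  have hd : ∫⁻ x, ‖fderiv ℝ (fun y => φ y ^ (m + 1)) x‖ₑ ≤
      (m + 1 : ℕ) * (K : ℝ≥0∞) ^ (1 / 2 : ℝ) := by
    calc _ ≤ ∫⁻ x, (m + 1 : ℕ) * (‖φ x‖ₑ ^ m * ‖fderiv ℝ φ x‖ₑ) :=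
          lintegral_mono fun x => enorm_fderiv_pow_le h1 m x
      _ = (m + 1 : ℕ) * ∫⁻ x, (‖φ x‖ₑ ^ m * ‖fderiv ℝ φ x‖ₑ) := by
          exact lintegral_const_mul _ ((hm.pow_const m).mul hm')
      _ ≤ (m + 1 : ℕ) * ((K : ℝ≥0∞) ^ (1 / 2 : ℝ) * 1 ^ (1 / 2 : ℝ)) := by
          gcongr
          refine lintegral_mul_le_sqrt_mul_sqrt (hm.pow_const _) hm' ?_ h4
          simp_rw [hpow]
          exact hK φ h1 h2 h3 h4
      _ = _ := by simp
  simp_rw [enorm_pow, hpow] at hG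
  refine hG.trans ?_
  rw [ENNReal.coe_mul, ENNReal.coe_rpow_of_nonneg _ zero_le_two, ENNReal.coe_mul,
    ENNReal.coe_rpow_of_nonneg _ (by norm_num)]
  gcongr
  simpa using hd

/-- All even exponents are reached from `2` by iteration, and the others lie below an even one. -/
theorem SobolevBound.dim_two {p : ℝ} (hp : 2 ≤ p) : SobolevBound 2 p := by
  have h : ∀ m : ℕ, SobolevBound 2 (2 * (m + 1 : ℕ)) := by
    intro m
    induction m with
    | zero => simpa using SobolevBound.two 2
    | succ m ih => exact ih.dim_two_step
  obtain ⟨m, hm⟩ := exists_nat_ge p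
  refine (h m).of_le hp ?_
  push_cast
  nlinarith

theorem SobolevBound.dim_ge_three (hN : 3 ≤ N) {p : ℝ} (hp : 2 ≤ p)
    (hp' : p ≤ 2 * N / ((N : ℝ) - 2)) : SobolevBound N p := by
  have hN' : (3 : ℝ) ≤ N := by exact_mod_cast hN
  refine SobolevBound.of_le ?_ hp hp'
  let r : NNReal := ⟨2 * N / ((N : ℝ) - 2), div_nonneg (by positivity) (by linarith)⟩
  have hr : 0 < (r : ℝ) := div_pos (by positivity) (by linarith)
  let C := eLpNormLESNormFDerivOfEqInnerConst (volume : Measure (Sp N)) (2 : NNReal)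
  refine ⟨C ^ (r : ℝ), fun φ h1 h2 h3 h4 => ?_⟩
  have hG := eLpNorm_le_eLpNorm_fderiv_of_eq_inner (volume : Measure (Sp N)) h1 h2
    (p := 2) (p' := r) (by norm_num) (by rw [finrank_euclideanSpace_fin]; omega) (by
      rw [finrank_euclideanSpace_fin]
      change (2 * N / ((N : ℝ) - 2))⁻¹ = _
      have : (N : ℝ) - 2 ≠ 0 := by linarith
      push_cast
      field_simp)
  have hr0 : r ≠ 0 := fun h => by rw [h] at hr; simp at hr
  rw [eLpNorm_nnreal_eq_lintegral hr0, eLpNorm_nnreal_eq_lintegral two_ne_zero] at hG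
  have h5 : (∫⁻ x, ‖fderiv ℝ φ x‖ₑ ^ ((2 : NNReal) : ℝ)) ^ (1 / ((2 : NNReal) : ℝ)) ≤ 1 :=
    ENNReal.rpow_le_one (by simpa using h4) (by norm_num)
  have h6 := (hG.trans (mul_le_mul_right h5 _))
  rw [mul_one, one_div, ENNReal.rpow_inv_le_iff hr] at h6
  refine h6.trans (le_of_eq ?_)
  rw [ENNReal.coe_rpow_of_nonneg _ hr.le]

/-- In dimension one a normalised function satisfies `|φ(x)|² ≤ ∫ 2 |φ| |φ'| ≤ 2`. -/
theorem enorm_sq_le_of_dim_one {φ : Sp 1 → ℂ} (h1 : ContDiff ℝ 1 φ) (h2 : HasCompactSupport φ)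
    (h3 : ∫⁻ x, ‖φ x‖ₑ ^ (2 : ℝ) ≤ 1) (h4 : ∫⁻ x, ‖fderiv ℝ φ x‖ₑ ^ (2 : ℝ) ≤ 1) (y : Sp 1) :
    ‖φ y‖ₑ ^ 2 ≤ 2 := by
  let L : ℝ ≃ₗᵢ[ℝ] Sp 1 := (OrthonormalBasis.singleton (Fin 1) ℝ).repr
  have hm : Measurable fun x => ‖φ x‖ₑ := h1.continuous.enorm.measurable
  have hm' : Measurable fun x => ‖fderiv ℝ φ x‖ₑ :=
    (h1.continuous_fderiv one_ne_zero).enorm.measurable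
  let f : ℝ → ℂ := fun t => φ (L t) ^ 2
  have hf : ContDiff ℝ 1 f := (h1.comp L.contDiff).pow 2
  have hf' : HasCompactSupport f :=
    (h2.comp_homeomorph L.toHomeomorph).comp_left (g := fun z : ℂ => z ^ 2) (by simp)
  have hd : ∀ t, ‖deriv f t‖ₑ ≤ 2 * (‖φ (L t)‖ₑ * ‖fderiv ℝ φ (L t)‖ₑ) := by
    intro t
    have hL : HasDerivAt (fun t => φ (L t)) (fderiv ℝ φ (L t) (L 1)) t :=
      (h1.differentiable one_ne_zero (L t)).hasFDerivAt.comp_hasDerivAt t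
        (L.toContinuousLinearEquiv : ℝ →L[ℝ] Sp 1).hasDerivAt
    rw [(hL.fun_pow 2).deriv]
    simp only [enorm_mul]
    rw [mul_assoc]
    gcongr
    · simp [enorm]
    · simp
    · refine (ContinuousLinearMap.le_opENorm _ _).trans ?_
      rw [L.enorm_map]
      simp
  have hx := hf'.enorm_le_lintegral_Ici_deriv hf (L.symm y)
  simp only [f, L.apply_symm_apply, enorm_pow] at hx
  refine hx.trans ?_
  calc _ ≤ ∫⁻ t, ‖deriv f t‖ₑ := setLIntegral_le_lintegral _ _
    _ ≤ ∫⁻ t, 2 * (‖φ (L t)‖ₑ * ‖fderiv ℝ φ (L t)‖ₑ) := lintegral_mono hd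
    _ = ∫⁻ x, 2 * (‖φ x‖ₑ * ‖fderiv ℝ φ x‖ₑ) :=
        L.measurePreserving.lintegral_comp
          (f := fun x => 2 * (‖φ x‖ₑ * ‖fderiv ℝ φ x‖ₑ)) ((hm.mul hm').const_mul 2)
    _ = 2 * ∫⁻ x, ‖φ x‖ₑ * ‖fderiv ℝ φ x‖ₑ := lintegral_const_mul _ (hm.mul hm')
    _ ≤ 2 * (1 ^ (1 / 2 : ℝ) * 1 ^ (1 / 2 : ℝ)) := by
        gcongr
        exact lintegral_mul_le_sqrt_mul_sqrt hm hm' h3 h4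
    _ = 2 := by simp

theorem SobolevBound.dim_one {p : ℝ} (hp : 2 ≤ p) : SobolevBound 1 p := by
  refine ⟨2 ^ ((p - 2) / 2), fun φ h1 h2 h3 h4 => ?_⟩
  have hm : Measurable fun x => ‖φ x‖ₑ := h1.continuous.enorm.measurable
  calc ∫⁻ x, ‖φ x‖ₑ ^ p ≤ ∫⁻ x, (2 : ℝ≥0∞) ^ ((p - 2) / 2) * ‖φ x‖ₑ ^ (2 : ℝ) := by
        refine lintegral_mono fun x => ?_
        have h5 := ENNReal.rpow_le_rpow (enorm_sq_le_of_dim_one h1 h2 h3 h4 x)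
          (z := (p - 2) / 2) (by linarith)
        rw [← ENNReal.rpow_natCast, ← ENNReal.rpow_mul] at h5
        calc ‖φ x‖ₑ ^ p = ‖φ x‖ₑ ^ (((2 : ℕ) : ℝ) * ((p - 2) / 2)) * ‖φ x‖ₑ ^ (2 : ℝ) := by
              rw [← ENNReal.rpow_add_of_nonneg _ _ (by push_cast; linarith) (by norm_num)]
              congr 1
              push_cast
              ring
          _ ≤ _ := by gcongr
    _ = (2 : ℝ≥0∞) ^ ((p - 2) / 2) * ∫⁻ x, ‖φ x‖ₑ ^ (2 : ℝ) :=
        lintegral_const_mul _ (hm.pow_const _)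
    _ ≤ (2 : ℝ≥0∞) ^ ((p - 2) / 2) * 1 := by gcongr
    _ = ((2 ^ ((p - 2) / 2) : NNReal) : ℝ≥0∞) := by
        rw [mul_one, ENNReal.coe_rpow_of_nonneg _ (by linarith)]
        simp

theorem sobolevBound_of_subcritical (hN : 1 ≤ N) {α : ℝ} (hα : 0 < α)
    (hcrit : 3 ≤ N → α ≤ 4 / ((N : ℝ) - 2)) : SobolevBound N (α + 2) := by
  rcases Nat.lt_or_ge N 3 with h | h
  · interval_cases N
    · exact SobolevBound.dim_one (by linarith)
    · exact SobolevBound.dim_two (by linarith)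
  · refine SobolevBound.dim_ge_three h (by linarith) ?_
    have h3 : (3 : ℝ) ≤ N := by exact_mod_cast h
    have h4 : 2 * (N : ℝ) / ((N : ℝ) - 2) = 4 / ((N : ℝ) - 2) + 2 := by
      have : (N : ℝ) - 2 ≠ 0 := by linarith
      field_simp
      ring
    linarith [hcrit h]

/-! ### The Sobolev embedding of `H¹` -/

/-- Cut-off functions with uniformly bounded gradients, exhausting `ℝ^N`. -/
theorem exists_cutoff (N : ℕ) : ∃ (χ : ℕ → Sp N → ℝ) (C : ℝ), 0 ≤ C ∧
    (∀ k, ContDiff ℝ 1 (χ k)) ∧ (∀ k, HasCompactSupport (χ k)) ∧ (∀ k x, ‖χ k x‖ ≤ 1) ∧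
    (∀ k x, ‖fderiv ℝ (χ k) x‖ ≤ C) ∧ ∀ x, Tendsto (fun k => χ k x) atTop (𝓝 1) := by
  let b : ContDiffBump (0 : Sp N) := ⟨1, 2, one_pos, one_lt_two⟩
  have hb : ContDiff ℝ 1 b := b.contDiff
  have hb' : HasCompactSupport (fderiv ℝ b) := b.hasCompactSupport.fderiv ℝ
  obtain ⟨C, hC⟩ := (hb.continuous_fderiv one_ne_zero).bounded_above_of_compact_support hb'
  have hC0 : 0 ≤ C := (norm_nonneg _).trans (hC 0)
  have hpos : ∀ k : ℕ, (0 : ℝ) < k + 1 := fun k => by positivity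
  refine ⟨fun k x => b (((k : ℝ) + 1)⁻¹ • x), C, hC0, fun k => ?_, fun k => ?_, fun k x => ?_,
    fun k x => ?_, fun x => ?_⟩
  · exact hb.comp (contDiff_const_smul _)
  · exact b.hasCompactSupport.comp_homeomorph
      (Homeomorph.smulOfNeZero ((k : ℝ) + 1)⁻¹ (inv_ne_zero (hpos k).ne'))
  · rw [Real.norm_of_nonneg b.nonneg]
    exact b.le_one
  · have h := ((hb.differentiable one_ne_zero (((k : ℝ) + 1)⁻¹ • x)).hasFDerivAt).comp x
      (((k : ℝ) + 1)⁻¹ • ContinuousLinearMap.id ℝ (Sp N)).hasFDerivAt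
    have h' : fderiv ℝ (fun x => b (((k : ℝ) + 1)⁻¹ • x)) x =
      (fderiv ℝ b (((k : ℝ) + 1)⁻¹ • x)).comp (((k : ℝ) + 1)⁻¹ • ContinuousLinearMap.id ℝ (Sp N)) :=
      h.fderiv
    rw [h', ContinuousLinearMap.comp_smul, ContinuousLinearMap.comp_id, norm_smul, norm_inv,
      Real.norm_of_nonneg (hpos k).le]
    calc _ ≤ 1 * C := by
          gcongr
          · exact inv_le_one_of_one_le₀ (by linarith [Nat.cast_nonneg (α := ℝ) k])
          · exact hC _
      _ = C := one_mul C
  · obtain ⟨n, hn⟩ := exists_nat_ge ‖x‖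
    refine tendsto_const_nhds.congr' ?_
    filter_upwards [eventually_ge_atTop n] with k hk
    refine (b.one_of_mem_closedBall ?_).symm
    have : (n : ℝ) ≤ k := by exact_mod_cast hk
    rw [mem_closedBall_zero_iff, norm_smul, norm_inv, Real.norm_of_nonneg (hpos k).le]
    change _ ≤ (1 : ℝ)
    rw [inv_mul_le_iff₀ (hpos k)]
    linarith

/-- Convexity of the square. -/
theorem enorm_rpow_two_le_of_norm_le {E F G : Type*} [NormedAddCommGroup E] [NormedAddCommGroup F]
    [NormedAddCommGroup G] {a : E} {b : F} {c : G} (h : ‖a‖ ≤ (‖b‖ + ‖c‖) / 2) :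
    ‖a‖ₑ ^ (2 : ℝ) ≤ 2⁻¹ * ‖b‖ₑ ^ (2 : ℝ) + 2⁻¹ * ‖c‖ₑ ^ (2 : ℝ) := by
  simp only [← ofReal_norm, ENNReal.rpow_two, ← ENNReal.ofReal_pow (norm_nonneg _)]
  have h2 : (2⁻¹ : ℝ≥0∞) = ENNReal.ofReal 2⁻¹ := by
    rw [ENNReal.ofReal_inv_of_pos two_pos]; simp
  rw [h2, ← ENNReal.ofReal_mul (by norm_num), ← ENNReal.ofReal_mul (by norm_num),
    ← ENNReal.ofReal_add (by positivity) (by positivity)]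
  refine ENNReal.ofReal_le_ofReal ?_
  nlinarith [sq_nonneg (‖b‖ - ‖c‖), norm_nonneg a, norm_nonneg b, norm_nonneg c,
    mul_self_le_mul_self (norm_nonneg a) h]

/-- The Sobolev inequality extends from compactly supported functions to Schwartz functions by
multiplication with cut-off functions and Fatou's lemma. -/
theorem SobolevBound.schwartz {p : ℝ} (hp : 0 ≤ p) (h : SobolevBound N p) :
    ∃ K : NNReal, ∀ φ : 𝓢(Sp N, ℂ), ∫⁻ x, ‖φ x‖ₑ ^ (2 : ℝ) ≤ 1 →
      ∫⁻ x, ‖fderiv ℝ φ x‖ₑ ^ (2 : ℝ) ≤ 1 → ∫⁻ x, ‖φ x‖ₑ ^ p ≤ K := by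
  obtain ⟨K, hK⟩ := h
  obtain ⟨χ, C, hC, h1, h2, h3, h4, h5⟩ := exists_cutoff N
  -- the factor `c` makes the gradient of `c χ φ` at most `(|∇φ| + |φ|) / 2`
  let c : ℝ := (2 * (1 + C))⁻¹
  have hc : 0 < c := by positivity
  have hc1 : c ≤ 1 / 2 := by
    rw [one_div]
    exact inv_anti₀ two_pos (by linarith)
  have hcC : c * C ≤ 1 / 2 := by
    have : c * (2 * (1 + C)) = 1 := inv_mul_cancel₀ (by positivity)
    nlinarith
  let K' : ℝ≥0∞ := K / ‖c‖ₑ ^ p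
  have hcp : ‖c‖ₑ ^ p ≠ 0 := by
    simp [ENNReal.rpow_eq_zero_iff, hc.ne']
  have hcp' : ‖c‖ₑ ^ p ≠ ⊤ := ENNReal.rpow_ne_top_of_nonneg hp enorm_ne_top
  have hK' : K' ≠ ⊤ := ENNReal.div_ne_top ENNReal.coe_ne_top hcp
  refine ⟨K'.toNNReal, fun φ h6 h7 => ?_⟩
  rw [ENNReal.coe_toNNReal hK']
  let ψ : ℕ → Sp N → ℂ := fun k x => (c * χ k x) • φ x
  have hφ : ContDiff ℝ 1 φ := φ.smooth 1
  have hcχ : ∀ k, ContDiff ℝ 1 fun x => c * χ k x := fun k => contDiff_const.mul (h1 k)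
  have hψ : ∀ k, ContDiff ℝ 1 (ψ k) := fun k => (hcχ k).smul hφ
  have hψc : ∀ k, HasCompactSupport (ψ k) := fun k =>
    HasCompactSupport.smul_right (f := fun x => c * χ k x) (HasCompactSupport.mul_left (h2 k))
  have hψ2 : ∀ k, ∫⁻ x, ‖ψ k x‖ₑ ^ (2 : ℝ) ≤ 1 := by
    intro k
    refine (lintegral_mono fun x => ?_).trans h6
    gcongr
    rw [enorm_le_iff_norm_le, norm_smul, norm_mul, Real.norm_of_nonneg hc.le]
    have := h3 k x
    have h0 : c * ‖χ k x‖ ≤ 1 := by nlinarith [norm_nonneg (χ k x)]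
    exact mul_le_of_le_one_left (norm_nonneg _) h0
  have hψd : ∀ k, ∫⁻ x, ‖fderiv ℝ (ψ k) x‖ₑ ^ (2 : ℝ) ≤ 1 := by
    intro k
    calc _ ≤ ∫⁻ x, (2⁻¹ * ‖fderiv ℝ φ x‖ₑ ^ (2 : ℝ) + 2⁻¹ * ‖φ x‖ₑ ^ (2 : ℝ)) := by
          refine lintegral_mono fun x => enorm_rpow_two_le_of_norm_le ?_
          have hd : fderiv ℝ (ψ k) x = (c * χ k x) • fderiv ℝ φ x +
              (c • fderiv ℝ (χ k) x).smulRight (φ x) := by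
            have ha := ((h1 k).differentiable one_ne_zero x).hasFDerivAt.const_mul c
            exact (ha.smul (hφ.differentiable one_ne_zero x).hasFDerivAt).fderiv
          rw [hd]
          refine (norm_add_le _ _).trans ?_
          rw [norm_smul, ContinuousLinearMap.norm_smulRight_apply, norm_smul, norm_mul,
            Real.norm_of_nonneg hc.le]
          have e1 : c * ‖χ k x‖ ≤ 1 / 2 := by nlinarith [h3 k x, norm_nonneg (χ k x)]
          have e2 : c * ‖fderiv ℝ (χ k) x‖ ≤ 1 / 2 :=
            (mul_le_mul_of_nonneg_left (h4 k x) hc.le).trans hcC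
          nlinarith [norm_nonneg (φ x), norm_nonneg (fderiv ℝ φ x)]
      _ = 2⁻¹ * (∫⁻ x, ‖fderiv ℝ φ x‖ₑ ^ (2 : ℝ)) + 2⁻¹ * ∫⁻ x, ‖φ x‖ₑ ^ (2 : ℝ) := by
          have m1 : Measurable fun x => ‖fderiv ℝ φ x‖ₑ ^ (2 : ℝ) :=
            (hφ.continuous_fderiv one_ne_zero).enorm.measurable.pow_const _
          have m2 : Measurable fun x => ‖φ x‖ₑ ^ (2 : ℝ) :=
            hφ.continuous.enorm.measurable.pow_const _
          rw [lintegral_add_left (m1.const_mul _), lintegral_const_mul _ m1,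
            lintegral_const_mul _ m2]
      _ ≤ 2⁻¹ * 1 + 2⁻¹ * 1 := by gcongr
      _ = 1 := by rw [mul_one, ENNReal.inv_two_add_inv_two]
  have hlim : ∀ x, Tendsto (fun k => ‖ψ k x‖ₑ ^ p) atTop (𝓝 (‖c‖ₑ ^ p * ‖φ x‖ₑ ^ p)) := by
    intro x
    have e1 : Tendsto (fun k => ψ k x) atTop (𝓝 ((c * 1) • φ x)) :=
      ((h5 x).const_mul c).smul_const _
    have e2 := (e1.enorm).ennrpow_const p
    rwa [mul_one, enorm_smul, ENNReal.mul_rpow_of_nonneg _ _ hp] at e2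
  have hF : ∫⁻ x, ‖c‖ₑ ^ p * ‖φ x‖ₑ ^ p ≤ K := by
    calc _ = ∫⁻ x, liminf (fun k => ‖ψ k x‖ₑ ^ p) atTop := by
          simp_rw [(hlim _).liminf_eq]
      _ ≤ liminf (fun k => ∫⁻ x, ‖ψ k x‖ₑ ^ p) atTop :=
          lintegral_liminf_le fun k => (hψ k).continuous.enorm.measurable.pow_const _
      _ ≤ K := by
          refine liminf_le_of_le (by isBoundedDefault) fun b hb => ?_
          obtain ⟨k, hk⟩ := hb.exists
          exact hk.trans (hK _ (hψ k) (hψc k) (hψ2 k) (hψd k))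
  rw [lintegral_const_mul _ (hφ.continuous.enorm.measurable.pow_const _)] at hF
  rwa [mul_comm, ← ENNReal.le_div_iff_mul_le (.inl hcp) (.inl hcp')] at hF

theorem lintegral_enorm_rpow_eq {p : ℝ} (hp : 0 < p) (g : LSp N (ENNReal.ofReal p)) :
    ∫⁻ x, ‖g x‖ₑ ^ p = ‖g‖ₑ ^ p := by
  rw [Lp.enorm_def, eLpNorm_eq_lintegral_rpow_enorm_toReal (by simpa using hp)
    ENNReal.ofReal_ne_top, ENNReal.toReal_ofReal hp.le, ← ENNReal.rpow_mul,
    one_div, inv_mul_cancel₀ hp.ne', ENNReal.rpow_one]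

theorem lintegral_enorm_rpow_two_eq (g : LSp N 2) :
    ∫⁻ x, ‖g x‖ₑ ^ (2 : ℝ) = ENNReal.ofReal (‖g‖ ^ 2) := by
  rw [ENNReal.ofReal_pow (norm_nonneg _), ofReal_norm, Lp.enorm_def,
    eLpNorm_eq_lintegral_rpow_enorm_toReal two_ne_zero ENNReal.ofNat_ne_top, ← ENNReal.rpow_two,
    ENNReal.toReal_ofNat, ← ENNReal.rpow_mul, one_div, inv_mul_cancel₀ two_ne_zero,
    ENNReal.rpow_one]

theorem H1.norm_sq_eq (f : H1 N) :
    ‖f‖ ^ 2 = ‖H1.toL2 N f‖ ^ 2 + ∑ j, ‖H1.partialDeriv N j f‖ ^ 2 := by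
  rw [Submodule.coe_norm, WithLp.prod_norm_sq_eq_of_L2, PiLp.norm_sq_eq_of_L2]
  rfl

/-- The operator norm of a linear form is at most the Euclidean norm of its coordinates. -/
theorem norm_sq_le_sum (L : Sp N →L[ℝ] ℂ) :
    ‖L‖ ^ 2 ≤ ∑ j, ‖L (EuclideanSpace.single j 1)‖ ^ 2 := by
  have h : ‖L‖ ≤ √(∑ j, ‖L (EuclideanSpace.single j 1)‖ ^ 2) := by
    refine ContinuousLinearMap.opNorm_le_bound _ (Real.sqrt_nonneg _) fun v => ?_
    have hv : v = ∑ j, v j • EuclideanSpace.single j (1 : ℝ) := by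
      ext i
      simp [Pi.single_apply]
    conv_lhs => rw [hv]
    rw [map_sum]
    refine (norm_sum_le _ _).trans ?_
    simp_rw [map_smul, norm_smul]
    rw [EuclideanSpace.norm_eq, mul_comm]
    exact Real.sum_mul_le_sqrt_mul_sqrt _ _ _
  calc ‖L‖ ^ 2 ≤ _ := pow_le_pow_left₀ (norm_nonneg _) h 2
    _ = _ := Real.sq_sqrt (by positivity)

theorem lintegral_fderiv_le (φ : 𝓢(Sp N, ℂ)) :
    ∫⁻ x, ‖fderiv ℝ φ x‖ₑ ^ (2 : ℝ) ≤ ENNReal.ofReal (‖H1.ofSchwartz φ‖ ^ 2) := by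
  let D : Fin N → 𝓢(Sp N, ℂ) := fun j => LineDeriv.lineDerivOp (EuclideanSpace.single j (1 : ℝ)) φ
  calc _ ≤ ∫⁻ x, ∑ j, ‖D j x‖ₑ ^ (2 : ℝ) := by
        refine lintegral_mono fun x => ?_
        simp only [← ofReal_norm, ENNReal.rpow_two, ← ENNReal.ofReal_pow (norm_nonneg _)]
        rw [← ENNReal.ofReal_sum_of_nonneg fun _ _ => by positivity]
        exact ENNReal.ofReal_le_ofReal (norm_sq_le_sum _)
    _ = ∑ j, ∫⁻ x, ‖D j x‖ₑ ^ (2 : ℝ) :=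
        lintegral_finsetSum _ fun j _ => (D j).continuous.enorm.measurable.pow_const _
    _ = ∑ j, ENNReal.ofReal (‖H1.partialDeriv N j (H1.ofSchwartz φ)‖ ^ 2) := by
        refine Finset.sum_congr rfl fun j _ => ?_
        rw [← lintegral_enorm_rpow_two_eq, H1.partialDeriv_ofSchwartz]
        refine lintegral_congr_ae ?_
        filter_upwards [(D j).coeFn_toLp 2] with x hx
        rw [hx]
    _ ≤ _ := by
        rw [← ENNReal.ofReal_sum_of_nonneg fun _ _ => by positivity]
        refine ENNReal.ofReal_le_ofReal ?_
        rw [H1.norm_sq_eq]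
        exact le_add_of_nonneg_left (by positivity)

theorem exists_subseq_ae_tendsto {f : ℕ → LSp N 2} {g : LSp N 2} (h : Tendsto f atTop (𝓝 g)) :
    ∃ ns : ℕ → ℕ, StrictMono ns ∧ ∀ᵐ x, Tendsto (fun k => f (ns k) x) atTop (𝓝 (g x)) :=
  (tendstoInMeasure_of_tendsto_Lp h).exists_seq_tendsto_ae

/-- The Sobolev inequality on the unit ball of `H¹`: along Schwartz functions converging in `H¹`, a
subsequence converges almost everywhere, and Fatou's lemma applies. -/
theorem SobolevBound.H1_ball {p : ℝ} (hp : 0 ≤ p) (h : SobolevBound N p) :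
    ∃ K : NNReal, ∀ f : H1 N, ‖f‖ < 1 → ∫⁻ x, ‖H1.toL2 N f x‖ₑ ^ p ≤ K := by
  obtain ⟨K, hK⟩ := h.schwartz hp
  refine ⟨K, fun f hf => ?_⟩
  obtain ⟨y, hy, hyf⟩ := mem_closure_iff_seq_limit.mp (H1.denseRange_ofSchwartz f)
  choose φ hφ using hy
  obtain rfl : (fun n => H1.ofSchwartz (φ n)) = y := funext hφ
  obtain ⟨ns, hns, hae⟩ := exists_subseq_ae_tendsto (((H1.toL2 N).continuous.tendsto f).comp hyf)
  have hb : ∀ᶠ k in atTop, ∫⁻ x, ‖φ (ns k) x‖ₑ ^ p ≤ K := by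
    have h1 := (hyf.comp hns.tendsto_atTop).norm.eventually (gt_mem_nhds hf)
    filter_upwards [h1] with k hk
    have hk' : ENNReal.ofReal (‖H1.ofSchwartz (φ (ns k))‖ ^ 2) ≤ 1 := by
      rw [ENNReal.ofReal_le_one]
      exact pow_le_one₀ (norm_nonneg _) hk.le
    refine hK _ ?_ ((lintegral_fderiv_le _).trans hk')
    refine le_trans ?_ hk'
    calc _ = ENNReal.ofReal (‖H1.toL2 N (H1.ofSchwartz (φ (ns k)))‖ ^ 2) := by
          rw [← lintegral_enorm_rpow_two_eq, H1.toL2_ofSchwartz]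
          refine lintegral_congr_ae ?_
          filter_upwards [(φ (ns k)).coeFn_toLp 2] with x hx
          rw [hx]
      _ ≤ _ := by
          refine ENNReal.ofReal_le_ofReal ?_
          rw [H1.norm_sq_eq (H1.ofSchwartz _)]
          exact le_add_of_nonneg_right (by positivity)
  have hae' : ∀ᵐ x, Tendsto (fun k => ‖φ (ns k) x‖ₑ ^ p) atTop (𝓝 (‖H1.toL2 N f x‖ₑ ^ p)) := by
    filter_upwards [hae, ae_all_iff.mpr fun k => (φ (ns k)).coeFn_toLp 2 volume] with x hx hx'
    refine Tendsto.ennrpow_const p (Tendsto.enorm (hx.congr fun k => ?_))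
    exact hx' k
  calc _ = ∫⁻ x, liminf (fun k => ‖φ (ns k) x‖ₑ ^ p) atTop :=
        lintegral_congr_ae (hae'.mono fun x hx => hx.liminf_eq.symm)
    _ ≤ liminf (fun k => ∫⁻ x, ‖φ (ns k) x‖ₑ ^ p) atTop :=
        lintegral_liminf_le fun k => (φ (ns k)).continuous.enorm.measurable.pow_const _
    _ ≤ K := by
        refine liminf_le_of_le (by isBoundedDefault) fun b hb' => ?_
        obtain ⟨k, hk, hk'⟩ := (hb'.and hb).exists
        exact hk.trans hk'

/-- The Sobolev embedding `H¹ ⊆ L^p` as a bounded operator. -/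
theorem SobolevBound.exists_embedding {p : ℝ} (hp : 1 ≤ p) [Fact (1 ≤ ENNReal.ofReal p)]
    (h : SobolevBound N p) :
    ∃ S : H1 N →L[ℂ] LSp N (ENNReal.ofReal p), ∀ f, S f =ᵐ[volume] H1.toL2 N f := by
  obtain ⟨K, hK⟩ := h.H1_ball (by linarith)
  have hp0 : ENNReal.ofReal p ≠ 0 := by
    rw [ne_eq, ENNReal.ofReal_eq_zero]; linarith
  have hnorm : ∀ f : Sp N → ℂ, eLpNorm f (ENNReal.ofReal p) volume =
      (∫⁻ x, ‖f x‖ₑ ^ p) ^ (1 / p) := by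
    intro f
    rw [eLpNorm_eq_lintegral_rpow_enorm_toReal hp0 ENNReal.ofReal_ne_top,
      ENNReal.toReal_ofReal (by linarith)]
  have hball : ∀ f : H1 N, ‖f‖ < 1 →
      eLpNorm (H1.toL2 N f) (ENNReal.ofReal p) volume ≤ ((K ^ (1 / p) : NNReal) : ℝ≥0∞) := by
    intro f hf
    rw [hnorm, ENNReal.coe_rpow_of_nonneg _ (by positivity)]
    exact ENNReal.rpow_le_rpow (hK f hf) (by positivity)
  have hmem : ∀ f : H1 N, MemLp (H1.toL2 N f) (ENNReal.ofReal p) volume := by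
    intro f
    have hc : (0 : ℝ) < ‖f‖ + 1 := by positivity
    let c : ℂ := ((‖f‖ + 1 : ℝ) : ℂ)
    have hc0 : c ≠ 0 := Complex.ofReal_ne_zero.mpr hc.ne'
    have h1 : ‖c⁻¹ • f‖ < 1 := by
      rw [norm_smul, norm_inv, Complex.norm_real, Real.norm_of_nonneg hc.le, inv_mul_lt_iff₀ hc]
      linarith
    have h2 : MemLp (H1.toL2 N (c⁻¹ • f)) (ENNReal.ofReal p) volume :=
      ⟨Lp.aestronglyMeasurable _, (hball _ h1).trans_lt ENNReal.coe_lt_top⟩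
    refine (h2.const_smul c).ae_eq ?_
    have h3 : H1.toL2 N f = c • H1.toL2 N (c⁻¹ • f) := by
      rw [← map_smul, smul_inv_smul₀ hc0]
    rw [h3]
    exact (Lp.coeFn_smul c _).symm
  let S : H1 N →ₗ[ℂ] LSp N (ENNReal.ofReal p) :=
    { toFun := fun f => (hmem f).toLp
      map_add' := fun f g => by
        rw [← MemLp.toLp_add]
        refine MemLp.toLp_congr _ _ ?_
        rw [map_add]
        exact Lp.coeFn_add _ _
      map_smul' := fun c f => by
        rw [RingHom.id_apply, ← MemLp.toLp_const_smul]
        refine MemLp.toLp_congr _ _ ?_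
        rw [map_smul]
        exact Lp.coeFn_smul _ _ }
  have hS : ∃ C, ∀ f, ‖S f‖ ≤ C * ‖f‖ := by
    refine LinearMap.bound_of_ball_bound one_pos ((K ^ (1 / p) : NNReal) : ℝ) S fun f hf => ?_
    rw [mem_ball_zero_iff] at hf
    change ‖(hmem f).toLp‖ ≤ _
    rw [Lp.norm_toLp]
    exact ENNReal.toReal_le_coe_of_le_coe (hball f hf)
  exact ⟨S.mkContinuousOfExistsBound hS, fun f => (hmem f).coeFn_toLp⟩

/-! ### The nonlinearity as an operator between Lebesgue spaces -/

theorem one_sub_rpow_le {α s : ℝ} (hα : 0 < α) (hs : 0 ≤ s) (hs1 : s ≤ 1) :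
    1 - s ^ α ≤ (1 + α) * (1 - s) := by
  rcases le_total α 1 with h | h
  · have h1 : s ≤ s ^ α := Real.self_le_rpow_of_le_one hs hs1 h
    nlinarith
  · have h1 := one_add_mul_self_le_rpow_one_add (s := s - 1) (by linarith) h
    rw [add_sub_cancel] at h1
    nlinarith

theorem norm_nonlin {α : ℝ} (hα : 0 < α) (z : ℂ) : ‖nonlin α z‖ = ‖z‖ ^ (α + 1) := by
  rw [nonlin, norm_mul, Complex.norm_real, Real.norm_of_nonneg (by positivity),
    Real.rpow_add_one' (norm_nonneg z) (by positivity)]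

/-- Local Lipschitz estimate for `g_α`. With `|a| ≤ |b|`, the difference is
`|b|^α (a - b) - (|b|^α - |a|^α) a`, and `(|b|^α - |a|^α) |b| ≤ (1 + α) |b|^α |a - b|`. -/
theorem norm_nonlin_sub_le {α : ℝ} (hα : 0 < α) (a b : ℂ) :
    ‖nonlin α a - nonlin α b‖ ≤ (2 + α) * (max ‖a‖ ‖b‖ ^ α * ‖a - b‖) := by
  wlog hab : ‖a‖ ≤ ‖b‖ generalizing a b
  · have := this b a (le_of_not_ge hab)
    rwa [norm_sub_rev, max_comm, norm_sub_rev a b]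
  rw [max_eq_right hab]
  rcases eq_or_ne b 0 with rfl | hb
  · have : a = 0 := by simpa using hab
    simp [this]
  have hy : 0 < ‖b‖ := norm_pos_iff.mpr hb
  have h1 : nonlin α a - nonlin α b =
      ((‖b‖ ^ α : ℝ) : ℂ) * (a - b) - ((‖b‖ ^ α - ‖a‖ ^ α : ℝ) : ℂ) * a := by
    simp only [nonlin]
    push_cast
    ring
  have hmono : ‖a‖ ^ α ≤ ‖b‖ ^ α := Real.rpow_le_rpow (norm_nonneg _) hab hα.le
  have h2 : (‖b‖ ^ α - ‖a‖ ^ α) * ‖b‖ ≤ (1 + α) * (‖b‖ ^ α * ‖a - b‖) := by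
    have h3 := one_sub_rpow_le hα (div_nonneg (norm_nonneg a) hy.le) (div_le_one_of_le₀ hab hy.le)
    rw [Real.div_rpow (norm_nonneg _) hy.le] at h3
    have hyα : 0 < ‖b‖ ^ α := Real.rpow_pos_of_pos hy α
    have h4 : ‖b‖ - ‖a‖ ≤ ‖a - b‖ := by
      rw [norm_sub_rev]; exact norm_sub_norm_le b a
    have h5 : (1 - ‖a‖ ^ α / ‖b‖ ^ α) * (‖b‖ ^ α * ‖b‖) = (‖b‖ ^ α - ‖a‖ ^ α) * ‖b‖ := by
      field_simp
    have h6 : (1 + α) * (1 - ‖a‖ / ‖b‖) * (‖b‖ ^ α * ‖b‖) =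
        (1 + α) * (‖b‖ ^ α * (‖b‖ - ‖a‖)) := by
      field_simp
    rw [← h5]
    refine (mul_le_mul_of_nonneg_right h3 (by positivity)).trans ?_
    rw [h6]
    gcongr
  rw [h1]
  refine (norm_sub_le _ _).trans ?_
  rw [norm_mul, norm_mul, Complex.norm_real, Complex.norm_real,
    Real.norm_of_nonneg (by positivity), Real.norm_of_nonneg (sub_nonneg.mpr hmono)]
  nlinarith [mul_le_mul_of_nonneg_left hab (sub_nonneg.mpr hmono)]

theorem continuous_nonlin {α : ℝ} (hα : 0 < α) : Continuous (nonlin α) := by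
  unfold nonlin
  exact (Complex.continuous_ofReal.comp
    (continuous_norm.rpow_const fun _ => Or.inr hα.le)).mul continuous_id

section Nemytskii

variable {α : ℝ} [hα : Fact (0 < α)]

theorem lintegral_enorm_rpow_expP (f : LSp N (expP α)) :
    ∫⁻ x, ‖f x‖ₑ ^ (α + 2) = ‖f‖ₑ ^ (α + 2) :=
  lintegral_enorm_rpow_eq (by linarith [hα.out]) f

theorem lintegral_enorm_rpow_expQ (f : LSp N (expQ α)) :
    ∫⁻ x, ‖f x‖ₑ ^ ((α + 2) / (α + 1)) = ‖f‖ₑ ^ ((α + 2) / (α + 1)) :=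
  lintegral_enorm_rpow_eq (div_pos (by linarith [hα.out]) (by linarith [hα.out])) f

theorem enorm_nonlin_rpow (z : ℂ) :
    ‖nonlin α z‖ₑ ^ ((α + 2) / (α + 1)) = ‖z‖ₑ ^ (α + 2) := by
  have h := hα.out
  rw [← ofReal_norm, ← ofReal_norm, norm_nonlin h, ENNReal.ofReal_rpow_of_nonneg (by positivity)
    (by positivity), ENNReal.ofReal_rpow_of_nonneg (by positivity) (by positivity),
    ← Real.rpow_mul (norm_nonneg _)]
  congr 2
  field_simp

theorem memLp_nonlin (f : LSp N (expP α)) :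
    MemLp (fun x => nonlin α (f x)) (expQ α) volume := by
  have h := hα.out
  refine ⟨(continuous_nonlin h).comp_aestronglyMeasurable (Lp.aestronglyMeasurable f), ?_⟩
  have hq : 0 < (α + 2) / (α + 1) := by positivity
  rw [expQ, eLpNorm_lt_top_iff_lintegral_rpow_enorm_lt_top (by simpa using hq)
    ENNReal.ofReal_ne_top, ENNReal.toReal_ofReal hq.le]
  simp_rw [enorm_nonlin_rpow]
  rw [lintegral_enorm_rpow_expP]
  exact ENNReal.rpow_lt_top_of_nonneg (by positivity) enorm_ne_top

/-- The superposition operator `f ↦ g_α(f)` from `L^(α+2)` to `L^((α+2)/(α+1))`. -/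
noncomputable def nemytskii (f : LSp N (expP α)) : LSp N (expQ α) := (memLp_nonlin f).toLp

theorem coeFn_nemytskii (f : LSp N (expP α)) :
    nemytskii f =ᵐ[volume] fun x => nonlin α (f x) := (memLp_nonlin f).coeFn_toLp

theorem norm_nemytskii (f : LSp N (expP α)) : ‖nemytskii f‖ = ‖f‖ ^ (α + 1) := by
  have h := hα.out
  have hq : 0 < (α + 2) / (α + 1) := by positivity
  have h1 : ‖nemytskii f‖ₑ ^ ((α + 2) / (α + 1)) = ‖f‖ₑ ^ (α + 2) := by
    rw [← lintegral_enorm_rpow_expQ, ← lintegral_enorm_rpow_expP]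
    refine lintegral_congr_ae ((coeFn_nemytskii f).mono fun x hx => ?_)
    simp only [hx, enorm_nonlin_rpow]
  rw [← ofReal_norm, ← ofReal_norm, ENNReal.ofReal_rpow_of_nonneg (by positivity)
    (by positivity), ENNReal.ofReal_rpow_of_nonneg (by positivity) (by positivity),
    ENNReal.ofReal_eq_ofReal_iff (by positivity) (by positivity)] at h1
  rw [← Real.rpow_left_inj (by positivity) (by positivity) hq.ne', h1,
    ← Real.rpow_mul (norm_nonneg _)]
  congr 1
  field_simp

/-- Hölder's inequality with exponents `(α + 1) / α` and `α + 1` applied to the local Lipschitz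
estimate for `g_α`. -/
theorem enorm_nemytskii_sub_rpow_le (f g : LSp N (expP α)) :
    ‖nemytskii f - nemytskii g‖ₑ ^ ((α + 2) / (α + 1)) ≤
      ENNReal.ofReal (2 + α) ^ ((α + 2) / (α + 1)) *
        ((‖f‖ₑ ^ (α + 2) + ‖g‖ₑ ^ (α + 2)) ^ (α / (α + 1)) *
          (‖f - g‖ₑ ^ (α + 2)) ^ (1 / (α + 1))) := by
  have h := hα.out
  let q := (α + 2) / (α + 1)
  have hq : 0 < q := by positivity
  have hf := (Lp.aestronglyMeasurable f).enorm
  have hg := (Lp.aestronglyMeasurable g).enorm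
  have hd := (Lp.aestronglyMeasurable (f - g)).enorm
  have hconj : ((α + 1) / α).HolderConjugate (α + 1) := by
    rw [Real.holderConjugate_iff]
    refine ⟨by rw [one_lt_div h]; linarith, ?_⟩
    field_simp
  calc ‖nemytskii f - nemytskii g‖ₑ ^ q
      = ∫⁻ x, ‖(nemytskii f - nemytskii g) x‖ₑ ^ q := (lintegral_enorm_rpow_expQ _).symm
    _ ≤ ∫⁻ x, ENNReal.ofReal (2 + α) ^ q *
          ((max ‖f x‖ₑ ‖g x‖ₑ) ^ (α * q) * ‖(f - g) x‖ₑ ^ q) := by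
        refine lintegral_mono_ae ?_
        filter_upwards [Lp.coeFn_sub (nemytskii f) (nemytskii g), coeFn_nemytskii f,
          coeFn_nemytskii g, Lp.coeFn_sub f g] with x h1 h2 h3 h4
        rw [h1, h4, Pi.sub_apply, Pi.sub_apply, h2, h3, ENNReal.rpow_mul,
          ← ENNReal.mul_rpow_of_nonneg _ _ hq.le, ← ENNReal.mul_rpow_of_nonneg _ _ hq.le]
        gcongr
        rw [← ofReal_norm, ← ofReal_norm, ← ofReal_norm, ← ofReal_norm, ← ENNReal.ofReal_max,
          ENNReal.ofReal_rpow_of_nonneg (by positivity) h.le,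
          ← ENNReal.ofReal_mul (by positivity), ← ENNReal.ofReal_mul (by positivity)]
        exact ENNReal.ofReal_le_ofReal (norm_nonlin_sub_le h _ _)
    _ = ENNReal.ofReal (2 + α) ^ q *
          ∫⁻ x, (max ‖f x‖ₑ ‖g x‖ₑ) ^ (α * q) * ‖(f - g) x‖ₑ ^ q := by
        rw [lintegral_const_mul' _ _ (ENNReal.rpow_ne_top_of_nonneg hq.le ENNReal.ofReal_ne_top)]
    _ ≤ ENNReal.ofReal (2 + α) ^ q *
          ((∫⁻ x, ((max ‖f x‖ₑ ‖g x‖ₑ) ^ (α * q)) ^ ((α + 1) / α)) ^ (1 / ((α + 1) / α)) *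
            (∫⁻ x, (‖(f - g) x‖ₑ ^ q) ^ (α + 1)) ^ (1 / (α + 1))) := by
        gcongr
        exact ENNReal.lintegral_mul_le_Lp_mul_Lq volume hconj
          ((hf.max hg).pow_const _) (hd.pow_const _)
    _ ≤ _ := by
        have e1 : α * q * ((α + 1) / α) = α + 2 := by simp only [q]; field_simp
        have e2 : q * (α + 1) = α + 2 := by simp only [q]; field_simp
        simp_rw [← ENNReal.rpow_mul]
        rw [e1, e2, lintegral_enorm_rpow_expP, one_div_div]
        gcongr
        · rw [← lintegral_enorm_rpow_expP f, ← lintegral_enorm_rpow_expP g,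
            ← lintegral_add_left' (hf.pow_const _)]
          refine lintegral_mono fun x => ?_
          rcases le_total ‖f x‖ₑ ‖g x‖ₑ with hx | hx
          · rw [max_eq_right hx]; exact le_add_self
          · rw [max_eq_left hx]; exact le_self_add
        · rw [← ENNReal.rpow_mul]

/-- Continuity in norm; it provides the strong measurability in time of `g_α(v)`. -/
theorem continuous_nemytskii : Continuous (nemytskii (N := N) (α := α)) := by
  have h := hα.out
  have hq : 0 < (α + 2) / (α + 1) := by positivity
  rw [continuous_iff_continuousAt]
  intro g
  rw [ContinuousAt, tendsto_iff_edist_tendsto_0]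
  simp_rw [edist_eq_enorm_sub]
  have h1 : Tendsto (fun f : LSp N (expP α) => ‖f‖ₑ ^ (α + 2) + ‖g‖ₑ ^ (α + 2)) (𝓝 g)
      (𝓝 (‖g‖ₑ ^ (α + 2) + ‖g‖ₑ ^ (α + 2))) :=
    ((continuous_enorm.tendsto g).ennrpow_const _).add tendsto_const_nhds
  have h2 : Tendsto (fun f : LSp N (expP α) => (‖f - g‖ₑ ^ (α + 2)) ^ (1 / (α + 1))) (𝓝 g)
      (𝓝 0) := by
    have e : Tendsto (fun f : LSp N (expP α) => ‖f - g‖ₑ) (𝓝 g) (𝓝 0) := by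
      have := ((continuous_id.sub (continuous_const (y := g))).enorm).tendsto g
      simpa using this
    have e2 := (e.ennrpow_const (α + 2)).ennrpow_const (1 / (α + 1))
    rwa [ENNReal.zero_rpow_of_pos (by positivity), ENNReal.zero_rpow_of_pos (by positivity)] at e2
  have h3 : (‖g‖ₑ ^ (α + 2) + ‖g‖ₑ ^ (α + 2)) ^ (α / (α + 1)) ≠ ⊤ := by
    refine ENNReal.rpow_ne_top_of_nonneg (by positivity) (ENNReal.add_ne_top.mpr ⟨?_, ?_⟩) <;>
    exact ENNReal.rpow_ne_top_of_nonneg (by positivity) enorm_ne_top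
  have h4 := ENNReal.Tendsto.const_mul
    (ENNReal.Tendsto.mul (h1.ennrpow_const (α / (α + 1))) (.inr ENNReal.zero_ne_top) h2 (.inr h3))
    (a := ENNReal.ofReal (2 + α) ^ ((α + 2) / (α + 1)))
    (.inr (ENNReal.rpow_ne_top_of_nonneg hq.le ENNReal.ofReal_ne_top))
  rw [mul_zero, mul_zero] at h4
  have h5 := tendsto_of_tendsto_of_tendsto_of_le_of_le tendsto_const_nhds h4 (fun _ => zero_le)
    (fun f => enorm_nemytskii_sub_rpow_le f g)
  have h6 := h5.ennrpow_const ((α + 2) / (α + 1))⁻¹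
  rw [ENNReal.zero_rpow_of_pos (inv_pos.mpr hq)] at h6
  refine h6.congr fun f => ?_
  rw [← ENNReal.rpow_mul, mul_inv_cancel₀ hq.ne', ENNReal.rpow_one]

end Nemytskii

/-! ### Weak convergence of the nonlinearities at fixed time -/

/-- A bounded sequence in `L^q` tending to zero almost everywhere tends weakly to zero. By Young's
inequality `f_n ψ ≤ δ f_n^q + min (f_n ψ, C_δ ψ^p)`, and the second term is dominated. -/
theorem tendsto_lintegral_mul_zero_of_ae {X : Type*} [MeasurableSpace X] {μ : Measure X}
    {p q : ℝ} (hpq : q.HolderConjugate p) {f : ℕ → X → ℝ≥0∞} {ψ : X → ℝ≥0∞}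
    (hf : ∀ n, AEMeasurable (f n) μ) (hψ : AEMeasurable ψ μ) {M : NNReal}
    (hM : ∀ n, ∫⁻ x, f n x ^ q ∂μ ≤ M) (hψp : ∫⁻ x, ψ x ^ p ∂μ ≠ ⊤)
    (hlim : ∀ᵐ x ∂μ, Tendsto (fun n => f n x) atTop (𝓝 0)) :
    Tendsto (fun n => ∫⁻ x, f n x * ψ x ∂μ) atTop (𝓝 0) := by
  have hψfin : ∀ᵐ x ∂μ, ψ x ≠ ⊤ := by
    filter_upwards [ae_lt_top' (hψ.pow_const p) hψp] with x hx hx'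
    rw [hx', ENNReal.top_rpow_of_pos hpq.symm.pos] at hx
    exact lt_irrefl _ hx
  rw [ENNReal.tendsto_nhds_zero]
  intro ε hε
  obtain ⟨η, hη0, hη⟩ : ∃ η : NNReal, 0 < η ∧ (η : ℝ≥0∞) * M ≤ ε / 2 := by
    have h2 : Tendsto (fun η : NNReal => (η : ℝ≥0∞) * M) (𝓝[>] 0) (𝓝 0) := by
      have : Continuous fun η : NNReal => (η : ℝ≥0∞) * M := by
        simp_rw [← ENNReal.coe_mul]
        fun_prop
      simpa using (this.tendsto 0).mono_left nhdsWithin_le_nhds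
    have h3 := (h2.eventually (ge_mem_nhds (ENNReal.half_pos hε.ne'))).and self_mem_nhdsWithin
    obtain ⟨η, h4, h5⟩ := h3.exists
    exact ⟨η, h5, h4⟩
  -- the weight in Young's inequality, chosen with `δ ^ q = η`
  let δ : NNReal := η ^ (1 / q)
  have hδ0 : δ ≠ 0 := (NNReal.rpow_pos hη0).ne'
  have hδ : (δ : ℝ≥0∞) ^ q = η := by
    rw [ENNReal.coe_rpow_of_nonneg _ (by have := hpq.pos; positivity), ← ENNReal.rpow_mul, one_div,
      inv_mul_cancel₀ hpq.pos.ne', ENNReal.rpow_one]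
  let B : X → ℝ≥0∞ := fun x => ((δ : ℝ≥0∞)⁻¹) ^ p * ψ x ^ p
  have hBint : ∫⁻ x, B x ∂μ ≠ ⊤ := by
    have hne : ((δ : ℝ≥0∞)⁻¹) ^ p ≠ ⊤ :=
      ENNReal.rpow_ne_top_of_nonneg hpq.symm.nonneg
        (ENNReal.inv_ne_top.mpr (by exact_mod_cast hδ0))
    rw [lintegral_const_mul' _ _ hne]
    exact ENNReal.mul_ne_top hne hψp
  have hdiv : ∀ (a : ℝ≥0∞) {r : ℝ}, 1 < r → a / ENNReal.ofReal r ≤ a := fun a r hr =>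
    ENNReal.div_le_of_le_mul (le_mul_of_one_le_right' (by
      rw [ENNReal.one_le_ofReal]; exact hr.le))
  have hyoung : ∀ n x, f n x * ψ x ≤ η * f n x ^ q + min (f n x * ψ x) (B x) := by
    intro n x
    have h1 : f n x * ψ x ≤ η * f n x ^ q + B x := by
      calc f n x * ψ x = (δ * f n x) * ((δ : ℝ≥0∞)⁻¹ * ψ x) := by
            rw [mul_mul_mul_comm, ENNReal.mul_inv_cancel (by exact_mod_cast hδ0)
              ENNReal.coe_ne_top, one_mul]
        _ ≤ (δ * f n x) ^ q / ENNReal.ofReal q + ((δ : ℝ≥0∞)⁻¹ * ψ x) ^ p / ENNReal.ofReal p :=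
            ENNReal.young_inequality _ _ hpq
        _ ≤ (δ * f n x) ^ q + ((δ : ℝ≥0∞)⁻¹ * ψ x) ^ p :=
            add_le_add (hdiv _ hpq.lt) (hdiv _ hpq.symm.lt)
        _ = _ := by
            rw [ENNReal.mul_rpow_of_nonneg _ _ hpq.nonneg, hδ,
              ENNReal.mul_rpow_of_nonneg _ _ hpq.symm.nonneg]
    rcases le_total (f n x * ψ x) (B x) with h2 | h2
    · rw [min_eq_left h2]; exact le_add_self
    · rwa [min_eq_right h2]
  have hBmeas : AEMeasurable B μ := (hψ.pow_const p).const_mul _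
  have hmin : Tendsto (fun n => ∫⁻ x, min (f n x * ψ x) (B x) ∂μ) atTop (𝓝 0) := by
    have := tendsto_lintegral_of_dominated_convergence' (μ := μ) (f := fun _ => 0) B
      (F := fun n x => min (f n x * ψ x) (B x)) (fun n => ((hf n).mul hψ).min hBmeas)
      (fun n => ae_of_all _ fun x => min_le_right _ _) hBint (by
        filter_upwards [hlim, hψfin] with x h1 h2
        have h3 := ENNReal.Tendsto.mul_const h1 (.inr h2)
        rw [zero_mul] at h3
        exact tendsto_of_tendsto_of_tendsto_of_le_of_le tendsto_const_nhds h3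
          (fun _ => zero_le) fun _ => min_le_left _ _)
    simpa using this
  filter_upwards [ENNReal.tendsto_nhds_zero.mp hmin (ε / 2) (ENNReal.half_pos hε.ne')] with n hn
  calc ∫⁻ x, f n x * ψ x ∂μ ≤ ∫⁻ x, (η * f n x ^ q + min (f n x * ψ x) (B x)) ∂μ :=
        lintegral_mono fun x => hyoung n x
    _ = (η * ∫⁻ x, f n x ^ q ∂μ) + ∫⁻ x, min (f n x * ψ x) (B x) ∂μ := by
        rw [lintegral_add_left' (((hf n).pow_const _).const_mul _),
          lintegral_const_mul' _ _ ENNReal.coe_ne_top]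
    _ ≤ η * M + ε / 2 := by gcongr; exact hM n
    _ ≤ ε / 2 + ε / 2 := by gcongr
    _ = ε := ENNReal.add_halves ε

/-- Bounded sequences in `L^((α+2)/(α+1))` that converge almost everywhere converge weakly. -/
theorem tendsto_lpDuality_of_ae {α : ℝ} [hα : Fact (0 < α)] {F : ℕ → LSp N (expQ α)}
    {G : LSp N (expQ α)} {M : ℝ} (hM : ∀ n, ‖F n‖ ≤ M)
    (hae : ∀ᵐ x, Tendsto (fun n => F n x) atTop (𝓝 (G x))) (ψ : LSp N (expP α)) :
    Tendsto (fun n => lpDuality N (expQ α) (expP α) (F n) ψ) atTop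
      (𝓝 (lpDuality N (expQ α) (expP α) G ψ)) := by
  have h := hα.out
  have hq : 0 < (α + 2) / (α + 1) := by positivity
  have hconj : ((α + 2) / (α + 1)).HolderConjugate (α + 2) := by
    rw [Real.holderConjugate_iff]
    refine ⟨by rw [one_lt_div (by linarith)]; linarith, ?_⟩
    field_simp
    ring
  have h1 : Tendsto (fun n => ∫⁻ x, ‖(F n - G) x‖ₑ * ‖ψ x‖ₑ) atTop (𝓝 0) := by
    refine tendsto_lintegral_mul_zero_of_ae hconj (M := ((M + ‖G‖) ^ ((α + 2) / (α + 1))).toNNReal)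
      (fun n => (Lp.aestronglyMeasurable (F n - G)).enorm)
      (Lp.aestronglyMeasurable ψ).enorm (fun n => ?_) ?_ ?_
    · rw [lintegral_enorm_rpow_expQ, ← ofReal_norm, ENNReal.ofReal_rpow_of_nonneg (norm_nonneg _)
        hq.le]
      refine ENNReal.ofReal_le_ofReal ?_
      gcongr
      exact (norm_sub_le _ _).trans (add_le_add_left (hM n) _)
    · rw [lintegral_enorm_rpow_expP]
      exact ENNReal.rpow_ne_top_of_nonneg (by positivity) enorm_ne_top
    · filter_upwards [hae, ae_all_iff.mpr fun n => Lp.coeFn_sub (F n) G] with x hx hx'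
      have h2 := (hx.sub_const (G x)).enorm
      rw [sub_self, enorm_zero] at h2
      refine h2.congr fun n => ?_
      rw [hx' n, Pi.sub_apply]
  rw [tendsto_iff_edist_tendsto_0]
  refine tendsto_of_tendsto_of_tendsto_of_le_of_le tendsto_const_nhds h1 (fun _ => zero_le)
    fun n => ?_
  rw [edist_eq_enorm_sub, ← sub_apply, ← map_sub, lpDuality,
    ContinuousLinearMap.lpPairing_eq_integral]
  refine (enorm_integral_le_lintegral_enorm _).trans (le_of_eq ?_)
  simp [enorm_mul]

/-- Along a sequence bounded in `H¹` and convergent in `L²`, the nonlinearities converge weakly in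
`L^((α+2)/(α+1))`. -/
theorem tendsto_lpDuality_nemytskii {α : ℝ} [hα : Fact (0 < α)]
    (S : H1 N →L[ℂ] LSp N (expP α)) (hS : ∀ f, S f =ᵐ[volume] H1.toL2 N f)
    {f : ℕ → H1 N} {g : H1 N} {M : ℝ} (hM : ∀ n, ‖f n‖ ≤ M)
    (hlim : Tendsto (fun n => H1.toL2 N (f n)) atTop (𝓝 (H1.toL2 N g))) (ψ : LSp N (expP α)) :
    Tendsto (fun n => lpDuality N (expQ α) (expP α) (nemytskii (S (f n))) ψ) atTop
      (𝓝 (lpDuality N (expQ α) (expP α) (nemytskii (S g)) ψ)) := by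
  have h := hα.out
  refine tendsto_of_subseq_tendsto fun ns hns => ?_
  obtain ⟨ms, -, hae⟩ := exists_subseq_ae_tendsto (hlim.comp hns)
  refine ⟨ms, tendsto_lpDuality_of_ae (M := (‖S‖ * M) ^ (α + 1)) (fun n => ?_) ?_ ψ⟩
  · rw [norm_nemytskii]
    gcongr
    exact S.le_of_opNorm_le_of_le le_rfl (hM _)
  · filter_upwards [hae, coeFn_nemytskii (S g), hS g,
      ae_all_iff.mpr fun n => coeFn_nemytskii (S (f n)), ae_all_iff.mpr fun n => hS (f n)]
      with x h1 h2 h3 h4 h5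
    simp only [h2, h4, h3, h5]
    exact ((continuous_nonlin h).tendsto _).comp h1

/-! ### Weak-* limits in `L^∞(Ω; X)` for a Hilbert space `X` -/

section WeakLimits

/-- Convergence to zero of equi-Lipschitz functions is a closed condition, so that limits may be
tested on dense sets. -/
theorem isClosed_setOf_tendsto_zero {E ι : Type*} [PseudoMetricSpace E] {l : Filter ι}
    {S : ι → E → ℝ} {C : ℝ} (hS : ∀ i x y, |S i x - S i y| ≤ C * dist x y) :
    IsClosed {x | Tendsto (fun i => S i x) l (𝓝 0)} := by
  refine isClosed_of_closure_subset fun x hx => ?_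
  rw [Set.mem_ofPred_eq, Metric.tendsto_nhds]
  intro ε hε
  have hC : 0 < 2 * (|C| + 1) := by positivity
  obtain ⟨y, hy, hxy⟩ := Metric.mem_closure_iff.mp hx (ε / (2 * (|C| + 1))) (by positivity)
  filter_upwards [Metric.tendsto_nhds.mp hy (ε / 2) (by positivity)] with i hi
  rw [Real.dist_eq, sub_zero] at hi ⊢
  rw [lt_div_iff₀ hC] at hxy
  have h1 := hS i x y
  have h2 : C * dist x y ≤ |C| * dist x y := mul_le_mul_of_nonneg_right (le_abs_self C) dist_nonneg
  have h3 := abs_sub_abs_le_abs_sub (S i x) (S i y)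
  nlinarith [dist_nonneg (x := x) (y := y)]

variable {X : Type*} [NormedAddCommGroup X] [InnerProductSpace ℂ X]

/-- A bounded sequence in a Hilbert space that converges weakly against a total set of vectors
converges weakly. -/
theorem exists_tendsto_inner [CompleteSpace X] {F : ℕ → X} {C : ℝ} (hF : ∀ n, ‖F n‖ ≤ C)
    (D : Set X)
    (hD : ∀ g, (∀ d ∈ D, inner ℂ d g = 0) → g = 0)
    (hlim : ∀ d ∈ D, ∃ l, Tendsto (fun n => inner ℂ (F n) d) atTop (𝓝 l)) :
    ∃ w : X, ∀ y, Tendsto (fun n => inner ℂ (F n) y) atTop (𝓝 (inner ℂ w y)) := by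
  have hlip : ∀ n (x y : X), dist (inner ℂ (F n) x) (inner ℂ (F n) y) ≤ C * dist x y := by
    intro n x y
    rw [dist_eq_norm, dist_eq_norm, ← inner_sub_right]
    exact (norm_inner_le_norm _ _).trans (mul_le_mul_of_nonneg_right (hF n) (norm_nonneg _))
  let V : Submodule ℂ X :=
    { carrier := {y | CauchySeq fun n => inner ℂ (F n) y}
      add_mem' := fun {a b} ha hb => by
        simp only [Set.mem_ofPred_eq, inner_add_right] at ha hb ⊢
        exact ha.add hb
      zero_mem' := by
        simp only [Set.mem_ofPred_eq, inner_zero_right]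
        exact cauchySeq_const 0
      smul_mem' := fun c a ha => by
        simp only [Set.mem_ofPred_eq, inner_smul_right] at ha ⊢
        obtain ⟨l, hl⟩ := cauchySeq_tendsto_of_complete ha
        exact (hl.const_mul c).cauchySeq }
  -- the vectors against which the sequence converges form a closed subspace containing `D`
  have hVclosed : IsClosed (V : Set X) := by
    have h := isClosed_setOf_tendsto_zero (l := atTop) (C := 2 * C)
      (S := fun (m : ℕ × ℕ) (y : X) => dist (inner ℂ (F m.1) y) (inner ℂ (F m.2) y)) (by
        intro m x y
        have h1 := dist_dist_dist_le (inner ℂ (F m.1) x) (inner ℂ (F m.2) x)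
          (inner ℂ (F m.1) y) (inner ℂ (F m.2) y)
        rw [Real.dist_eq] at h1
        linarith [hlip m.1 x y, hlip m.2 x y])
    convert h using 1
    ext y
    exact cauchySeq_iff_tendsto_dist_atTop_0
  have hVtop : V = ⊤ := by
    rw [← hVclosed.submodule_topologicalClosure_eq, Submodule.topologicalClosure_eq_top_iff,
      Submodule.eq_bot_iff]
    refine fun g hg => hD g fun d hd => hg d ?_
    obtain ⟨l, hl⟩ := hlim d hd
    exact hl.cauchySeq
  have hlim' : ∀ y, ∃ l, Tendsto (fun n => inner ℂ (F n) y) atTop (𝓝 l) := fun y =>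
    cauchySeq_tendsto_of_complete (show y ∈ V from hVtop ▸ Submodule.mem_top)
  choose T hT using hlim'
  let L : X →ₗ[ℂ] ℂ :=
    { toFun := T
      map_add' := fun x y => tendsto_nhds_unique (hT (x + y)) (by
        simp_rw [inner_add_right]
        exact (hT x).add (hT y))
      map_smul' := fun c x => tendsto_nhds_unique (hT (c • x)) (by
        simp_rw [inner_smul_right]
        exact (hT x).const_mul c) }
  let L' : X →L[ℂ] ℂ := L.mkContinuous C fun y =>
    le_of_tendsto (hT y).norm (Eventually.of_forall fun n =>
      (norm_inner_le_norm _ _).trans (mul_le_mul_of_nonneg_right (hF n) (norm_nonneg _)))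
  refine ⟨(InnerProductSpace.toDual ℂ X).symm L', fun y => ?_⟩
  rw [InnerProductSpace.toDual_symm_apply]
  exact hT y

variable {Ω : Type*} [MeasurableSpace Ω] {μ : Measure Ω}

theorem ae_norm_le_norm {E : Type*} [NormedAddCommGroup E] (f : Lp E ⊤ μ) :
    ∀ᵐ t ∂μ, ‖f t‖ ≤ ‖f‖ := by
  filter_upwards [ae_le_eLpNormEssSup (f := f) (μ := μ)] with t ht
  rw [Lp.norm_def, eLpNorm_exponent_top, ← toReal_enorm]
  refine ENNReal.toReal_mono ?_ ht
  rw [← eLpNorm_exponent_top]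
  exact Lp.eLpNorm_ne_top f

theorem Lp_one_integrable {E : Type*} [NormedAddCommGroup E] (φ : Lp E 1 μ) : Integrable φ μ :=
  memLp_one_iff_integrable.mp (Lp.memLp φ)

theorem integrable_inner_Lp (f : Lp X ⊤ μ) (φ : Lp X 1 μ) :
    Integrable (fun t => inner ℂ (f t) (φ t)) μ := by
  refine ((Lp_one_integrable φ).norm.const_mul ‖f‖).mono'
    ((Lp.aestronglyMeasurable f).inner (Lp.aestronglyMeasurable φ)) ?_
  filter_upwards [ae_norm_le_norm f] with t ht
  exact (norm_inner_le_norm _ _).trans (mul_le_mul_of_nonneg_right ht (norm_nonneg _))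

theorem norm_integral_inner_le (f : Lp X ⊤ μ) (φ : Lp X 1 μ) :
    ‖∫ t, inner ℂ (f t) (φ t) ∂μ‖ ≤ ‖f‖ * ‖φ‖ := by
  rw [L1.norm_eq_integral_norm, ← integral_const_mul]
  refine norm_integral_le_of_norm_le ((Lp_one_integrable φ).norm.const_mul _) ?_
  filter_upwards [ae_norm_le_norm f] with t ht
  exact (norm_inner_le_norm _ _).trans (mul_le_mul_of_nonneg_right ht (norm_nonneg _))

theorem integral_inner_sub_right (f : Lp X ⊤ μ) (φ ψ : Lp X 1 μ) :
    ∫ t, inner ℂ (f t) ((φ - ψ) t) ∂μ =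
      (∫ t, inner ℂ (f t) (φ t) ∂μ) - ∫ t, inner ℂ (f t) (ψ t) ∂μ := by
  rw [← integral_sub (integrable_inner_Lp f φ) (integrable_inner_Lp f ψ)]
  refine integral_congr_ae ?_
  filter_upwards [Lp.coeFn_sub φ ψ] with t ht
  rw [ht, Pi.sub_apply, inner_sub_right]

theorem integral_inner_sub_left (f g : Lp X ⊤ μ) (φ : Lp X 1 μ) :
    ∫ t, inner ℂ ((f - g) t) (φ t) ∂μ =
      (∫ t, inner ℂ (f t) (φ t) ∂μ) - ∫ t, inner ℂ (g t) (φ t) ∂μ := by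
  rw [← integral_sub (integrable_inner_Lp f φ) (integrable_inner_Lp g φ)]
  refine integral_congr_ae ?_
  filter_upwards [Lp.coeFn_sub f g] with t ht
  rw [ht, Pi.sub_apply, inner_sub_left]

theorem tendsto_integral_inner {f : ℕ → Lp X ⊤ μ} {g : Lp X ⊤ μ}
    (h : Tendsto (fun n => ‖f n - g‖) atTop (𝓝 0)) (φ : Lp X 1 μ) :
    Tendsto (fun n => ∫ t, inner ℂ (f n t) (φ t) ∂μ) atTop (𝓝 (∫ t, inner ℂ (g t) (φ t) ∂μ)) := by
  rw [tendsto_iff_norm_sub_tendsto_zero]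
  refine squeeze_zero (fun _ => norm_nonneg _) (fun n => ?_) (by simpa using h.mul_const ‖φ‖)
  rw [← integral_inner_sub_left]
  exact norm_integral_inner_le _ _

variable [IsFiniteMeasure μ]

/-- A weak `L²` limit of functions with values in the ball of radius `C` has values in this ball:
test with the limit itself on the set where it exceeds `C`. -/
theorem ae_norm_le_of_tendsto_inner {F : ℕ → Lp X 2 μ} {w : Lp X 2 μ} {C : ℝ}
    (hF : ∀ n, ∀ᵐ t ∂μ, ‖F n t‖ ≤ C)
    (hw : ∀ y, Tendsto (fun n => inner ℂ (F n) y) atTop (𝓝 (inner ℂ w y))) :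
    ∀ᵐ t ∂μ, ‖w t‖ ≤ C := by
  let A : Set Ω := {t | C < ‖w t‖}
  have hA : MeasurableSet A := measurableSet_lt measurable_const
    (Lp.stronglyMeasurable w).norm.measurable
  have hy : MemLp (A.indicator w) 2 μ := (Lp.memLp w).indicator hA
  let y : Lp X 2 μ := hy.toLp _
  have hye : y =ᵐ[μ] A.indicator w := hy.coeFn_toLp
  have hint1 : Integrable (fun t => C * ‖y t‖) μ :=
    ((Lp.memLp y).integrable one_le_two).norm.const_mul C
  have hsq : Integrable (fun t => ‖y t‖ ^ 2) μ := (Lp.memLp y).integrable_norm_pow two_ne_zero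
  have h1 : inner ℂ w y = ((∫ t, ‖y t‖ ^ 2 ∂μ : ℝ) : ℂ) := by
    rw [L2.inner_def, ← integral_complex_ofReal]
    refine integral_congr_ae ?_
    filter_upwards [hye] with t ht
    rw [ht]
    by_cases htA : t ∈ A
    · rw [Set.indicator_of_mem htA, inner_self_eq_norm_sq_to_K]
      norm_cast
    · rw [Set.indicator_of_notMem htA]
      simp
  have h2 : ∀ n, ‖inner ℂ (F n) y‖ ≤ ∫ t, C * ‖y t‖ ∂μ := by
    intro n
    rw [L2.inner_def]
    refine norm_integral_le_of_norm_le hint1 ?_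
    filter_upwards [hF n] with t ht
    exact (norm_inner_le_norm _ _).trans (mul_le_mul_of_nonneg_right ht (norm_nonneg _))
  have h3 := le_of_tendsto (hw y).norm (Eventually.of_forall h2)
  rw [h1, Complex.norm_real, Real.norm_of_nonneg (integral_nonneg fun _ => by positivity)] at h3
  have h4 : 0 ≤ᵐ[μ] fun t => ‖y t‖ ^ 2 - C * ‖y t‖ := by
    filter_upwards [hye] with t ht
    rw [ht]
    by_cases htA : t ∈ A
    · rw [Set.indicator_of_mem htA]
      have : C < ‖w t‖ := htA
      simp only [Pi.zero_apply]
      nlinarith [norm_nonneg (w t)]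
    · rw [Set.indicator_of_notMem htA]
      simp
  have h5 : (∫ t, (‖y t‖ ^ 2 - C * ‖y t‖) ∂μ) = 0 := by
    refine le_antisymm ?_ (integral_nonneg_of_ae h4)
    rw [integral_sub hsq hint1]
    linarith
  rw [integral_eq_zero_iff_of_nonneg_ae h4 (hsq.sub hint1)] at h5
  filter_upwards [h5, hye, hF 0] with t h6 h7 h8
  by_contra! h9
  rw [h7, Set.indicator_of_mem (show t ∈ A from h9)] at h6
  have hC : 0 ≤ C := (norm_nonneg _).trans h8
  simp only [Pi.zero_apply] at h6
  nlinarith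

/-- Bounded sequences in `L^∞(Ω; X)`, for a Hilbert space `X` and a finite measure, that converge
against a total set of `L²` functions converge weakly-*. -/
theorem exists_weakStar_limit [CompleteSpace X] {f : ℕ → Lp X ⊤ μ} {C : ℝ} (hf : ∀ n, ‖f n‖ ≤ C)
    (D : Set (Lp X 2 μ)) (hD : ∀ g, (∀ d ∈ D, inner ℂ d g = 0) → g = 0)
    (hlim : ∀ d ∈ D, ∃ l, Tendsto (fun n => ∫ t, inner ℂ (f n t) (d t) ∂μ) atTop (𝓝 l)) :
    ∃ v : Lp X ⊤ μ, ∀ φ : Lp X 1 μ,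
      Tendsto (fun n => ∫ t, inner ℂ (f n t) (φ t) ∂μ) atTop
        (𝓝 (∫ t, inner ℂ (v t) (φ t) ∂μ)) := by
  have hC : 0 ≤ C := (norm_nonneg _).trans (hf 0)
  have hmem : ∀ n, MemLp (f n) 2 μ := fun n => (Lp.memLp (f n)).mono_exponent le_top
  let F : ℕ → Lp X 2 μ := fun n => (hmem n).toLp
  have hFae : ∀ n, F n =ᵐ[μ] f n := fun n => (hmem n).coeFn_toLp
  have hFC : ∀ n, ∀ᵐ t ∂μ, ‖F n t‖ ≤ C := fun n => by
    filter_upwards [hFae n, ae_norm_le_norm (f n)] with t h1 h2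
    rw [h1]
    exact h2.trans (hf n)
  have hinner : ∀ n d, inner ℂ (F n) d = ∫ t, inner ℂ (f n t) (d t) ∂μ := fun n d => by
    rw [L2.inner_def]
    exact integral_congr_ae ((hFae n).mono fun t ht => by simp only [ht])
  obtain ⟨w, hw⟩ := exists_tendsto_inner (fun n => Lp.norm_le_of_ae_bound hC (hFC n)) D hD
    (fun d hd => by simp_rw [hinner]; exact hlim d hd)
  have hwC := ae_norm_le_of_tendsto_inner hFC hw
  have hv : MemLp w ⊤ μ := memLp_top_of_bound (Lp.aestronglyMeasurable w) C hwC
  let v : Lp X ⊤ μ := hv.toLp _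
  have hve : v =ᵐ[μ] w := hv.coeFn_toLp
  refine ⟨v, fun φ => ?_⟩
  rw [tendsto_iff_norm_sub_tendsto_zero]
  refine (Lp.simpleFunc.denseRange (E := X) (μ := μ) ENNReal.one_ne_top).induction_on
    (p := fun φ => Tendsto (fun n => ‖(∫ t, inner ℂ (f n t) (φ t) ∂μ) -
      ∫ t, inner ℂ (v t) (φ t) ∂μ‖) atTop (𝓝 0)) φ ?_ fun s => ?_
  · refine isClosed_setOf_tendsto_zero (C := C + ‖v‖) (S := fun n (φ : Lp X 1 μ) =>
      ‖(∫ t, inner ℂ (f n t) (φ t) ∂μ) - ∫ t, inner ℂ (v t) (φ t) ∂μ‖)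
      fun n φ ψ => ?_
    refine (abs_norm_sub_norm_le _ _).trans ?_
    rw [← integral_inner_sub_left, ← integral_inner_sub_left, ← integral_inner_sub_right,
      dist_eq_norm]
    refine (norm_integral_inner_le _ _).trans ?_
    gcongr
    exact (norm_sub_le _ _).trans (by gcongr; exact hf n)
  · rw [← tendsto_iff_norm_sub_tendsto_zero]
    have hs := Lp.simpleFunc.toSimpleFunc_eq_toFun s
    have hs2 : MemLp (Lp.simpleFunc.toSimpleFunc s) 2 μ :=
      SimpleFunc.memLp_of_isFiniteMeasure _ _ _
    let y : Lp X 2 μ := hs2.toLp _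
    have hye : y =ᵐ[μ] Lp.simpleFunc.toSimpleFunc s := hs2.coeFn_toLp
    have h1 : ∀ g : Ω → X, ∫ t, inner ℂ (g t) (y t) ∂μ =
        ∫ t, inner ℂ (g t) ((s : Lp X 1 μ) t) ∂μ := fun g => by
      refine integral_congr_ae ?_
      filter_upwards [hs, hye] with t h2 h3
      rw [h3, h2]
    have h2 := hw y
    simp_rw [hinner, h1] at h2
    rw [L2.inner_def, h1] at h2
    refine h2.congr' ?_ |>.trans (le_of_eq ?_)
    · rfl
    · congr 1
      exact integral_congr_ae (hve.mono fun t ht => by simp only [ht])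

end WeakLimits

/-! ### Dual spaces and lifting of limits through an injection -/

section Hilbert

variable {Ω : Type*} [MeasurableSpace Ω] {μ : Measure Ω}

/-- The Riesz isomorphism from the dual of a Hilbert space, as a conjugate-linear operator. -/
noncomputable def riesz (X : Type*) [NormedAddCommGroup X] [InnerProductSpace ℂ X]
    [CompleteSpace X] : (X →L[ℂ] ℂ) →L⋆[ℂ] X :=
  (InnerProductSpace.toDual ℂ X).symm.toLinearIsometry.toContinuousLinearMap

/-- The conjugate-linear embedding of a Hilbert space into its dual. -/
noncomputable def rieszInv (X : Type*) [NormedAddCommGroup X] [InnerProductSpace ℂ X]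
    [CompleteSpace X] : X →L⋆[ℂ] (X →L[ℂ] ℂ) :=
  (InnerProductSpace.toDual ℂ X).toLinearIsometry.toContinuousLinearMap

variable {X Z : Type*} [NormedAddCommGroup X] [InnerProductSpace ℂ X] [CompleteSpace X]
  [NormedAddCommGroup Z] [InnerProductSpace ℂ Z] [CompleteSpace Z]

theorem inner_riesz (ℓ : X →L[ℂ] ℂ) (x : X) : inner ℂ (riesz X ℓ) x = ℓ x :=
  InnerProductSpace.toDual_symm_apply

theorem rieszInv_apply (x y : X) : rieszInv X x y = inner ℂ x y := rfl

/-- Weak-* compactness in `L^∞(Ω; X')` for the dual `X'` of a Hilbert space `X`, with the whole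
sequence converging when the pairings with a total set converge. -/
theorem exists_weakStar_limit_dual [IsFiniteMeasure μ] {w : ℕ → Lp (X →L[ℂ] ℂ) ⊤ μ} {C : ℝ}
    (hw : ∀ n, ‖w n‖ ≤ C) (D : Set (Lp X 2 μ))
    (hD : ∀ g, (∀ d ∈ D, inner ℂ d g = 0) → g = 0)
    (hlim : ∀ d ∈ D, ∃ l, Tendsto (fun n => ∫ t, w n t (d t) ∂μ) atTop (𝓝 l)) :
    ∃ v : Lp (X →L[ℂ] ℂ) ⊤ μ, ∀ φ : Lp X 1 μ,
      Tendsto (fun n => ∫ t, w n t (φ t) ∂μ) atTop (𝓝 (∫ t, v t (φ t) ∂μ)) := by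
  have e1 : ∀ n (g : Ω → X), ∫ t, inner ℂ ((riesz X).compLp (w n) t) (g t) ∂μ =
      ∫ t, w n t (g t) ∂μ := by
    intro n g
    refine integral_congr_ae (((riesz X).coeFn_compLp (w n)).mono fun t ht => ?_)
    simp only [ht, inner_riesz]
  obtain ⟨v, hv⟩ := exists_weakStar_limit (f := fun n => (riesz X).compLp (w n))
    (C := ‖riesz X‖ * C) (fun n => ((riesz X).norm_compLp_le _).trans (by gcongr; exact hw n)) D hD
    (fun d hd => by simp_rw [e1]; exact hlim d hd)
  refine ⟨(rieszInv X).compLp v, fun φ => ?_⟩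
  have h := hv φ
  simp_rw [e1] at h
  convert h using 2
  refine integral_congr_ae (((rieszInv X).coeFn_compLp v).mono fun t ht => ?_)
  simp only [ht, rieszInv_apply]

/-- A bounded sequence in `L^∞(Ω; X)` whose image under an injective operator `T` converges in
norm: the limit lifts to `L^∞(Ω; X)`, and the sequence converges weakly-* to the lift. -/
theorem exists_weakStar_lift [IsFiniteMeasure μ] (T : X →L[ℂ] Z) (hT : Function.Injective T)
    {f : ℕ → Lp X ⊤ μ} {C : ℝ} (hf : ∀ n, ‖f n‖ ≤ C) {u : Lp Z ⊤ μ}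
    (hu : Tendsto (fun n => ‖T.compLp (f n) - u‖) atTop (𝓝 0)) :
    ∃ v : Lp X ⊤ μ, T.compLp v = u ∧ ∀ φ : Lp (X →L[ℂ] ℂ) 1 μ,
      Tendsto (fun n => ∫ t, φ t (f n t) ∂μ) atTop (𝓝 (∫ t, φ t (v t) ∂μ)) := by
  let T' : Z →L[ℂ] X := ContinuousLinearMap.adjoint T
  have e1 : ∀ (g : Lp X ⊤ μ) (y : Lp Z 1 μ), ∫ t, inner ℂ (g t) (T'.compLp y t) ∂μ =
      ∫ t, inner ℂ (T.compLp g t) (y t) ∂μ := by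
    intro g y
    refine integral_congr_ae ?_
    filter_upwards [T'.coeFn_compLp y, T.coeFn_compLp g] with t h1 h2
    rw [h1, h2, ContinuousLinearMap.adjoint_inner_right]
  have hlim1 : ∀ y : Lp Z 1 μ, Tendsto (fun n => ∫ t, inner ℂ (f n t) (T'.compLp y t) ∂μ) atTop
      (𝓝 (∫ t, inner ℂ (u t) (y t) ∂μ)) := by
    intro y
    simp_rw [e1]
    exact tendsto_integral_inner hu y
  obtain ⟨v, hv⟩ := exists_weakStar_limit hf (Set.range fun y : Lp Z 2 μ => T'.compLp y)
    (by
      intro g hg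
      -- orthogonality to `T* T g` says `‖T g‖ = 0`
      have h1 := hg _ ⟨T.compLp g, rfl⟩
      have h2 : inner ℂ (T.compLp g) (T.compLp g) = (0 : ℂ) := by
        rw [← h1, L2.inner_def, L2.inner_def]
        refine integral_congr_ae ?_
        filter_upwards [T'.coeFn_compLp (T.compLp g), T.coeFn_compLp g] with t h3 h4
        rw [h3, ContinuousLinearMap.adjoint_inner_left, h4]
      rw [inner_self_eq_zero] at h2
      rw [Lp.eq_zero_iff_ae_eq_zero] at h2 ⊢
      filter_upwards [h2, T.coeFn_compLp g] with t h3 h4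
      apply hT
      rw [← h4, h3, Pi.zero_apply, Pi.zero_apply, map_zero])
    (by
      rintro _ ⟨y, rfl⟩
      have hy : MemLp y 1 μ := (Lp.memLp y).mono_exponent one_le_two
      refine ⟨_, (hlim1 (hy.toLp _)).congr fun n => ?_⟩
      refine integral_congr_ae ?_
      filter_upwards [T'.coeFn_compLp (hy.toLp y), T'.coeFn_compLp y, hy.coeFn_toLp]
        with t h1 h2 h3
      rw [h1, h2, h3])
  -- `T v - u` is an admissible test function for itself, and both weak limits agree against it
  have hTv : T.compLp v = u := by
    rw [← sub_eq_zero, Lp.eq_zero_iff_ae_eq_zero]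
    let z : Lp Z ⊤ μ := T.compLp v - u
    have hz : MemLp z 1 μ := (Lp.memLp z).mono_exponent le_top
    have h1 : ∫ t, inner ℂ (z t) (hz.toLp z t) ∂μ = 0 := by
      rw [integral_inner_sub_left, ← e1, sub_eq_zero]
      exact tendsto_nhds_unique (hv _) (hlim1 _)
    have h2 : ∫ t, inner ℂ (z t) (hz.toLp z t) ∂μ = ((∫ t, ‖z t‖ ^ 2 ∂μ : ℝ) : ℂ) := by
      rw [← integral_complex_ofReal]
      refine integral_congr_ae (hz.coeFn_toLp.mono fun t ht => ?_)
      simp only [ht, inner_self_eq_norm_sq_to_K]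
      norm_cast
    rw [h2, Complex.ofReal_eq_zero, integral_eq_zero_iff_of_nonneg (fun _ => by positivity)
      (((Lp.memLp z).mono_exponent le_top).integrable_norm_pow two_ne_zero)] at h1
    filter_upwards [h1] with t ht
    have h3 : z t = 0 := by simpa using ht
    exact h3
  refine ⟨v, hTv, fun φ => ?_⟩
  have e2 : ∀ g : Ω → X, ∫ t, φ t (g t) ∂μ =
      starRingEnd ℂ (∫ t, inner ℂ (g t) ((riesz X).compLp φ t) ∂μ) := by
    intro g
    rw [← integral_conj]
    refine integral_congr_ae (((riesz X).coeFn_compLp φ).mono fun t ht => ?_)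
    simp only [ht, inner_conj_symm, inner_riesz]
  simp_rw [e2]
  exact (Complex.continuous_conj.tendsto _).comp (hv _)

end Hilbert

/-! ### Weak-* limits of time derivatives -/

section TimeDerivative

theorem isFiniteMeasure_restrict_of_isBounded {I : Set ℝ} (hI : Bornology.IsBounded I) :
    IsFiniteMeasure ((volume : Measure ℝ).restrict I) :=
  ⟨by rw [Measure.restrict_apply_univ]; exact hI.measure_lt_top⟩

/-- Test functions only see the interior of `I`; for an interval nothing is lost. -/
theorem ae_mem_interior {I : Set ℝ} (hI : I.OrdConnected) :
    ∀ᵐ t ∂((volume : Measure ℝ).restrict I), t ∈ interior I := by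
  have h : ∀ᵐ t : ℝ, t ∉ frontier I :=
    measure_eq_zero_iff_ae_notMem.mp (hI.convex.addHaar_frontier volume)
  filter_upwards [ae_restrict_of_ae h, ae_restrict_mem hI.measurableSet] with t h1 h2
  by_contra h3
  exact h1 ⟨subset_closure h2, h3⟩

theorem norm_integral_smul_le {I : Set ℝ} {E : Type*} [NormedAddCommGroup E] [NormedSpace ℂ E]
    [IsFiniteMeasure ((volume : Measure ℝ).restrict I)] {g : ℝ → ℂ} {M : ℝ} (hM : ∀ t, ‖g t‖ ≤ M)
    (a : LInfty I E) :
    ‖∫ t in I, g t • a t‖ ≤ M * ‖a‖ * volume.real I := by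
  have h := norm_integral_le_of_norm_le_const (μ := (volume : Measure ℝ).restrict I)
    (f := fun t => g t • a t) (C := M * ‖a‖) (by
      filter_upwards [ae_norm_le_norm a] with t ht
      rw [norm_smul]
      exact mul_le_mul (hM t) ht (norm_nonneg _) ((norm_nonneg _).trans (hM t)))
  simpa using h

theorem integrable_smul_LInfty {I : Set ℝ} {E : Type*} [NormedAddCommGroup E] [NormedSpace ℂ E]
    [IsFiniteMeasure ((volume : Measure ℝ).restrict I)] {g : ℝ → ℂ} (hg : Continuous g)
    (hgc : HasCompactSupport g) (a : LInfty I E) :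
    Integrable (fun t => g t • a t) ((volume : Measure ℝ).restrict I) := by
  obtain ⟨M, hM⟩ := hg.bounded_above_of_compact_support hgc
  have ha : Integrable a ((volume : Measure ℝ).restrict I) := (Lp.memLp a).integrable le_top
  exact ha.bdd_smul M hg.aestronglyMeasurable (ae_of_all _ hM)

theorem tendsto_integral_smul {I : Set ℝ} {E : Type*} [NormedAddCommGroup E] [NormedSpace ℂ E]
    [IsFiniteMeasure ((volume : Measure ℝ).restrict I)] {g : ℝ → ℂ} (hg : Continuous g)
    (hgc : HasCompactSupport g) {a : ℕ → LInfty I E} {b : LInfty I E}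
    (h : Tendsto (fun n => ‖a n - b‖) atTop (𝓝 0)) :
    Tendsto (fun n => ∫ t in I, g t • a n t) atTop (𝓝 (∫ t in I, g t • b t)) := by
  obtain ⟨M, hM⟩ := hg.bounded_above_of_compact_support hgc
  rw [tendsto_iff_norm_sub_tendsto_zero]
  refine squeeze_zero (fun _ => norm_nonneg _) (fun n => ?_)
    (by simpa using (h.const_mul M).mul_const (volume.real I))
  rw [← integral_sub (integrable_smul_LInfty hg hgc _) (integrable_smul_LInfty hg hgc _)]
  refine le_trans (le_of_eq ?_) (norm_integral_smul_le hM (a n - b))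
  congr 1
  refine integral_congr_ae ?_
  filter_upwards [Lp.coeFn_sub (a n) b] with t ht
  rw [ht, Pi.sub_apply, smul_sub]

variable {X : Type*} [NormedAddCommGroup X] [InnerProductSpace ℂ X]

/-- Products `η(t) e` of a real test function supported in the interior of an interval and a vector
are total in `L²(I; X)`. -/
theorem eq_zero_of_forall_inner_test [CompleteSpace X] {I : Set ℝ} (hI : I.OrdConnected)
    [IsFiniteMeasure ((volume : Measure ℝ).restrict I)]
    (g : Lp X 2 ((volume : Measure ℝ).restrict I))
    (hg : ∀ (d : Lp X 2 ((volume : Measure ℝ).restrict I)) (η : ℝ → ℝ) (e : X),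
      ContDiff ℝ ∞ η → HasCompactSupport η → tsupport η ⊆ interior I →
      d =ᵐ[(volume : Measure ℝ).restrict I] (fun t => (η t : ℂ) • e) → inner ℂ d g = 0) :
    g = 0 := by
  have hgi : Integrable g ((volume : Measure ℝ).restrict I) :=
    (Lp.memLp g).integrable one_le_two
  have h := IsOpen.ae_eq_zero_of_integral_contDiff_smul_eq_zero (isOpen_interior (s := I))
    (hgi.locallyIntegrable.locallyIntegrableOn _) (fun η h1 h2 h3 => by
      -- the vector `y = ∫ η g` is itself used as the factor `e`, so that `‖y‖² = ⟪η y, g⟫ = 0`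
      rw [← inner_self_eq_zero (𝕜 := ℂ)]
      generalize hy : ∫ t in I, η t • g t = y
      nth_rewrite 2 [← hy]
      have hint : Integrable (fun t => η t • g t) ((volume : Measure ℝ).restrict I) := by
        obtain ⟨M, hM⟩ := h1.continuous.bounded_above_of_compact_support h2
        have h4 : Integrable (fun t => (η t : ℂ) • g t) ((volume : Measure ℝ).restrict I) :=
          hgi.bdd_smul M (Complex.continuous_ofReal.comp h1.continuous).aestronglyMeasurable
            (ae_of_all _ fun t => by simpa using hM t)
        exact h4
      rw [← integral_inner hint]
      have hd : MemLp (fun t => (η t : ℂ) • y) 2 ((volume : Measure ℝ).restrict I) :=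
        Continuous.memLp_of_hasCompactSupport
          ((Complex.continuous_ofReal.comp h1.continuous).smul continuous_const)
          (HasCompactSupport.smul_right (f := fun t => (η t : ℂ))
            (h2.comp_left Complex.ofReal_zero))
      have h4 := hg (hd.toLp _) η y h1 h2 h3 hd.coeFn_toLp
      rw [← h4, L2.inner_def]
      refine integral_congr_ae (hd.coeFn_toLp.mono fun t ht => ?_)
      simp only [ht, inner_smul_left, Complex.conj_ofReal]
      rw [← Complex.coe_smul, inner_smul_right])
  rw [Lp.eq_zero_iff_ae_eq_zero]
  filter_upwards [h, ae_mem_interior hI] with t h1 h2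
  exact h1 h2

/-- Bounded time derivatives of a norm-convergent sequence in `L^∞(I; X')` converge weakly-* to the
time derivative of the limit. -/
theorem exists_timeDeriv_limit [CompleteSpace X] {I : Set ℝ} (hI : I.OrdConnected)
    [IsFiniteMeasure ((volume : Measure ℝ).restrict I)]
    {a w : ℕ → LInfty I (X →L[ℂ] ℂ)} {b : LInfty I (X →L[ℂ] ℂ)}
    (ha : Tendsto (fun n => ‖a n - b‖) atTop (𝓝 0)) (haw : ∀ n, IsTimeDeriv I (a n) (w n))
    {C : ℝ} (hw : ∀ n, ‖w n‖ ≤ C) :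
    ∃ v : LInfty I (X →L[ℂ] ℂ), IsTimeDeriv I b v ∧ ∀ φ : LOne I X,
      Tendsto (fun n => ∫ t in I, w n t (φ t)) atTop (𝓝 (∫ t in I, v t (φ t))) := by
  have happ : ∀ (v : LInfty I (X →L[ℂ] ℂ)) {η : ℝ → ℂ} (_ : Continuous η)
      (_ : HasCompactSupport η) (e : X) {d : ℝ → X}
      (_ : d =ᵐ[(volume : Measure ℝ).restrict I] fun t => η t • e),
      ∫ t in I, v t (d t) = (∫ t in I, η t • v t) e := by
    intro v η h1 h2 e d hd
    rw [ContinuousLinearMap.integral_apply (integrable_smul_LInfty h1 h2 v)]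
    refine integral_congr_ae (hd.mono fun t ht => ?_)
    simp only [ht, map_smul, smul_apply]
  have hlim : ∀ η : ℝ → ℂ, ContDiff ℝ ∞ η → HasCompactSupport η → tsupport η ⊆ interior I →
      Tendsto (fun n => ∫ t in I, η t • w n t) atTop (𝓝 (-∫ t in I, deriv η t • b t)) := by
    intro η h1 h2 h3
    have h4 := (tendsto_integral_smul (h1.continuous_deriv (by simp)) h2.deriv ha).neg
    refine h4.congr fun n => ?_
    rw [haw n η h1 h2 h3, neg_neg]
  obtain ⟨v, hv⟩ := exists_weakStar_limit_dual hw
    {d | ∃ (η : ℝ → ℝ) (e : X), ContDiff ℝ ∞ η ∧ HasCompactSupport η ∧ tsupport η ⊆ interior I ∧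
      d =ᵐ[(volume : Measure ℝ).restrict I] (fun t => (η t : ℂ) • e)}
    (fun g hg => eq_zero_of_forall_inner_test hI g fun d η e h1 h2 h3 h4 =>
      hg d ⟨η, e, h1, h2, h3, h4⟩)
    (by
      rintro d ⟨η, e, h1, h2, h3, h4⟩
      have h5 : ContDiff ℝ ∞ (fun t => (η t : ℂ)) := Complex.ofRealCLM.contDiff.comp h1
      have h6 : HasCompactSupport (fun t => (η t : ℂ)) := h2.comp_left Complex.ofReal_zero
      have h7 : tsupport (fun t => (η t : ℂ)) ⊆ interior I :=
        (tsupport_comp_subset Complex.ofReal_zero η).trans h3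
      have h8 := hlim _ h5 h6 h7
      refine ⟨_, (((ContinuousLinearMap.apply ℂ ℂ e).continuous.tendsto _).comp h8).congr
        fun n => ?_⟩
      exact (happ (w n) h5.continuous h6 e h4).symm)
  refine ⟨v, fun η h1 h2 h3 => ?_, hv⟩
  rw [eq_comm, neg_eq_iff_eq_neg]
  ext e
  have hd : MemLp (fun t => η t • e) 1 ((volume : Measure ℝ).restrict I) :=
    Continuous.memLp_of_hasCompactSupport (h1.continuous.smul continuous_const)
      (HasCompactSupport.smul_right h2)
  have h4 := hv (hd.toLp _)
  rw [happ v h1.continuous h2 e hd.coeFn_toLp] at h4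
  refine tendsto_nhds_unique h4 ?_
  refine (((ContinuousLinearMap.apply ℂ ℂ e).continuous.tendsto _).comp
    (hlim η h1 h2 h3)).congr fun n => ?_
  exact (happ (w n) h1.continuous h2 e hd.coeFn_toLp).symm

end TimeDerivative

/-! ### Convergence in the Bochner spaces over `H¹` and `H⁻¹` -/

variable {I : Set ℝ}

section Abstract

variable {X Y Z : Type*} [NormedAddCommGroup X] [NormedSpace ℂ X] [NormedAddCommGroup Y]
  [NormedSpace ℂ Y] [NormedAddCommGroup Z] [InnerProductSpace ℂ Z] [CompleteSpace Z]

theorem LInfty.coeFn_map (L : X →L[ℂ] Y) (u : LInfty I X) :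
    ∀ᵐ t ∂((volume : Measure ℝ).restrict I), LInfty.map I L u t = L (u t) := L.coeFn_compLp u

theorem LInfty.tendsto_map (L : X →L[ℂ] Y) {a : ℕ → LInfty I X} {u : LInfty I X}
    (h : Tendsto (fun n => ‖a n - u‖) atTop (𝓝 0)) :
    Tendsto (fun n => ‖LInfty.map I L (a n) - LInfty.map I L u‖) atTop (𝓝 0) := by
  refine squeeze_zero (fun _ => norm_nonneg _) (fun n => ?_) (by simpa using h.const_mul ‖L‖)
  have e : LInfty.map I L (a n) - LInfty.map I L u = L.compLp (a n - u) :=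
    (map_sub (L.compLpL ⊤ ((volume : Measure ℝ).restrict I)) (a n) u).symm
  rw [e]
  exact L.norm_compLp_le _

/-- A symmetric operator `X → X'` is continuous from the weak-* topology of `L^∞(I; X)`, with test
functions in `L¹(I; X')`, to that of `L^∞(I; X')`, with test functions in `L¹(I; X)`. -/
theorem weakStarTendsto_map_of_symm (L : X →L[ℂ] X →L[ℂ] ℂ) (hL : ∀ x y, L x y = L y x)
    {f : ℕ → LInfty I X} {v : LInfty I X}
    (h : WeakStarTendsto (Y := X →L[ℂ] ℂ) I (ContinuousLinearMap.apply ℂ ℂ) f v) :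
    WeakStarTendsto (X := X →L[ℂ] ℂ) I (ContinuousLinearMap.id ℂ _)
      (fun n => LInfty.map I L (f n)) (LInfty.map I L v) := by
  intro φ
  have e : ∀ g : LInfty I X, ∫ t in I, (ContinuousLinearMap.id ℂ (X →L[ℂ] ℂ))
      (LInfty.map I L g t) (φ t) =
      ∫ t in I, ContinuousLinearMap.apply ℂ ℂ (g t) (L.compLp φ t) := by
    intro g
    refine integral_congr_ae ?_
    filter_upwards [L.coeFn_compLp φ, LInfty.coeFn_map L g] with t h1 h2
    rw [h1, h2, ContinuousLinearMap.apply_apply, ContinuousLinearMap.id_apply, hL]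
  simp_rw [e]
  exact h (L.compLp φ)

/-- `exists_weakStar_lift` for a normed space whose norm comes from an inner product. Keeping the
normed structure as the given one fixes the module structure from which the dual is formed. -/
theorem weakStarTendsto_lift {X : Type*} [NormedAddCommGroup X] [inst : NormedSpace ℂ X]
    [CompleteSpace X] (ip : InnerProductSpace ℂ X) (hip : ip.toNormedSpace = inst)
    [IsFiniteMeasure ((volume : Measure ℝ).restrict I)]
    (T : X →L[ℂ] Z) (hT : Function.Injective T)
    {f : ℕ → LInfty I X} {C : ℝ} (hf : ∀ n, ‖f n‖ ≤ C) {u : LInfty I Z}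
    (hu : Tendsto (fun n => ‖LInfty.map I T (f n) - u‖) atTop (𝓝 0)) :
    ∃ v : LInfty I X, LInfty.map I T v = u ∧
      WeakStarTendsto (Y := X →L[ℂ] ℂ) I (ContinuousLinearMap.apply ℂ ℂ) f v := by
  subst hip
  exact exists_weakStar_lift T hT hf hu

/-- `exists_timeDeriv_limit` for a normed space whose norm comes from an inner product. -/
theorem weakStarTendsto_timeDeriv {X : Type*} [NormedAddCommGroup X] [inst : NormedSpace ℂ X]
    [CompleteSpace X] (ip : InnerProductSpace ℂ X) (hip : ip.toNormedSpace = inst)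
    (hI : I.OrdConnected) [IsFiniteMeasure ((volume : Measure ℝ).restrict I)]
    {a w : ℕ → LInfty I (X →L[ℂ] ℂ)} {b : LInfty I (X →L[ℂ] ℂ)}
    (ha : Tendsto (fun n => ‖a n - b‖) atTop (𝓝 0)) (haw : ∀ n, IsTimeDeriv I (a n) (w n))
    {C : ℝ} (hw : ∀ n, ‖w n‖ ≤ C) :
    ∃ v : LInfty I (X →L[ℂ] ℂ), IsTimeDeriv I b v ∧
      WeakStarTendsto (X := X →L[ℂ] ℂ) I (ContinuousLinearMap.id ℂ _) w v := by
  subst hip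
  exact exists_timeDeriv_limit hI ha haw hw

end Abstract

theorem laplacian_symm (u φ : H1 N) : laplacian N u φ = laplacian N φ u := by
  have h : ∀ f g : LSp N 2, lpDuality N 2 2 f g = lpDuality N 2 2 g f := by
    intro f g
    rw [lpDuality, ContinuousLinearMap.lpPairing_eq_integral,
      ContinuousLinearMap.lpPairing_eq_integral]
    simp only [ContinuousLinearMap.mul_apply', mul_comm]
  simp only [laplacian, neg_apply, sum_apply, ContinuousLinearMap.bilinearComp_apply]
  exact congrArg _ (Finset.sum_congr rfl fun j _ => h _ _)

section Nonlinearity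

variable {α : ℝ} [hα : Fact (0 < α)] (S : H1 N →L[ℂ] LSp N (expP α))

theorem memLp_nemytskii_comp (v : LInfty I (H1 N)) :
    MemLp (fun t => nemytskii (S (v t))) ⊤ ((volume : Measure ℝ).restrict I) := by
  have h := hα.out
  refine memLp_top_of_bound ((continuous_nemytskii.comp S.continuous).comp_aestronglyMeasurable
    (Lp.aestronglyMeasurable v)) ((‖S‖ * ‖v‖) ^ (α + 1)) ?_
  filter_upwards [ae_norm_le_norm v] with t ht
  rw [norm_nemytskii]
  gcongr
  exact S.le_of_opNorm_le_of_le le_rfl ht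

/-- The element `t ↦ g_α(v(t))` of `L^∞(I; L^((α+2)/(α+1)))`. -/
noncomputable def nonlinLInfty (v : LInfty I (H1 N)) : LInfty I (LSp N (expQ α)) :=
  (memLp_nemytskii_comp S v).toLp

theorem coeFn_nonlinLInfty (v : LInfty I (H1 N)) :
    ∀ᵐ t ∂((volume : Measure ℝ).restrict I), nonlinLInfty S v t = nemytskii (S (v t)) :=
  (memLp_nemytskii_comp S v).coeFn_toLp

theorem isNonlin_nonlinLInfty (hS : ∀ f, S f =ᵐ[volume] H1.toL2 N f) (v : LInfty I (H1 N)) :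
    IsNonlin I α (LInfty.toL2 I v) (nonlinLInfty S v) := by
  filter_upwards [coeFn_nonlinLInfty S v, (H1.toL2 N).coeFn_compLp v] with t h1 h2
  have h3 : LInfty.toL2 I v t = H1.toL2 N (v t) := h2
  rw [h1, h3]
  filter_upwards [coeFn_nemytskii (S (v t)), hS (v t)] with x h4 h5
  rw [h4, h5]

/-- Weak convergence at almost every time, together with the domination
`|⟨g_α(u_n(t)), φ(t)⟩| ≤ M ‖φ(t)‖`, gives weak-* convergence by dominated convergence. -/
theorem weakStarTendsto_nonlinLInfty (hS : ∀ f, S f =ᵐ[volume] H1.toL2 N f)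
    {un : ℕ → LInfty I (H1 N)} {v : LInfty I (H1 N)} {C : ℝ} (hC : ∀ n, ‖un n‖ ≤ C)
    (hconv : Tendsto (fun n => ‖LInfty.toL2 I (un n) - LInfty.toL2 I v‖) atTop (𝓝 0)) :
    WeakStarTendsto I (lpDuality N (expQ α) (expP α)) (fun n => nonlinLInfty S (un n))
      (nonlinLInfty S v) := by
  have h := hα.out
  intro φ
  let M := ‖lpDuality N (expQ α) (expP α)‖ * (‖S‖ * C) ^ (α + 1)
  refine tendsto_integral_of_dominated_convergence (fun t => M * ‖φ t‖) (fun n => ?_)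
    ((Lp_one_integrable φ).norm.const_mul M) (fun n => ?_) ?_
  · exact (lpDuality N (expQ α) (expP α)).aestronglyMeasurable_comp₂
      (Lp.aestronglyMeasurable _) (Lp.aestronglyMeasurable _)
  · filter_upwards [coeFn_nonlinLInfty S (un n), ae_norm_le_norm (un n)] with t h1 h2
    rw [h1]
    refine ContinuousLinearMap.le_of_opNorm₂_le_of_le _ le_rfl ?_ le_rfl
    rw [norm_nemytskii]
    gcongr
    exact S.le_of_opNorm_le_of_le le_rfl (h2.trans (hC n))
  · filter_upwards [ae_all_iff.mpr fun n => coeFn_nonlinLInfty S (un n), coeFn_nonlinLInfty S v,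
      ae_all_iff.mpr fun n => ae_norm_le_norm (un n),
      ae_all_iff.mpr fun n => ae_norm_le_norm (LInfty.toL2 I (un n) - LInfty.toL2 I v),
      ae_all_iff.mpr fun n => Lp.coeFn_sub (LInfty.toL2 I (un n)) (LInfty.toL2 I v),
      ae_all_iff.mpr fun n => (H1.toL2 N).coeFn_compLp (un n), (H1.toL2 N).coeFn_compLp v]
      with t h1 h2 h3 h4 h5 h6 h7
    simp only [h1, h2]
    refine tendsto_lpDuality_nemytskii S hS (fun n => (h3 n).trans (hC n)) ?_ (φ t)
    rw [tendsto_iff_norm_sub_tendsto_zero]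
    refine squeeze_zero (fun _ => norm_nonneg _) (fun n => ?_) hconv
    refine le_trans (le_of_eq ?_) (h4 n)
    rw [h5 n, Pi.sub_apply]
    exact congrArg norm (congrArg₂ _ (h6 n).symm h7.symm)

end Nonlinearity

/-- Stated for arbitrary seminormed groups, which keeps the unifier from unfolding the norm of
`L^∞(I; H⁻¹)` where the bound is used. -/
theorem norm_right_le_of_add_le {E F : Type*} [SeminormedAddCommGroup E]
    [SeminormedAddCommGroup F] {a : ℕ → E} {w : ℕ → F} {C : ℝ} (h : ∀ n, ‖a n‖ + ‖w n‖ ≤ C)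
    (n : ℕ) : ‖w n‖ ≤ C :=
  (le_add_of_nonneg_left (norm_nonneg _)).trans (h n)

section Sobolev

variable {un : ℕ → LInfty I (H1 N)} {C : ℝ}

theorem exists_weakStarTendsto_H1 (hIb : Bornology.IsBounded I) (hC : ∀ n, ‖un n‖ ≤ C)
    {u : LInfty I (LSp N 2)} (hconv : Tendsto (fun n => ‖LInfty.toL2 I (un n) - u‖) atTop (𝓝 0)) :
    ∃ v : LInfty I (H1 N), LInfty.toL2 I v = u ∧
      WeakStarTendsto (Y := Hm1 N) I (pairH1 N) un v := by
  have := isFiniteMeasure_restrict_of_isBounded hIb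
  exact weakStarTendsto_lift (H1 N).innerProductSpace rfl (H1.toL2 N) H1.toL2_injective hC hconv

theorem weakStarTendsto_laplacian {v : LInfty I (H1 N)}
    (h : WeakStarTendsto (Y := Hm1 N) I (pairH1 N) un v) :
    WeakStarTendsto (X := Hm1 N) I (pairHm1 N) (fun n => LInfty.laplacian I (un n))
      (LInfty.laplacian I v) :=
  weakStarTendsto_map_of_symm (laplacian N) laplacian_symm h

theorem exists_weakStarTendsto_timeDeriv_toHm1 (hI : I.OrdConnected)
    (hIb : Bornology.IsBounded I) {a : ℕ → LInfty I (LSp N 2)} {b : LInfty I (LSp N 2)}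
    (hab : Tendsto (fun n => ‖a n - b‖) atTop (𝓝 0)) {w : ℕ → LInfty I (Hm1 N)}
    (haw : ∀ n, IsTimeDeriv I (LInfty.toHm1 I (a n)) (w n))
    (hC : ∀ n, ‖LInfty.toHm1 I (a n)‖ + ‖w n‖ ≤ C) :
    ∃ v : LInfty I (Hm1 N), IsTimeDeriv I (LInfty.toHm1 I b) v ∧
      WeakStarTendsto (X := Hm1 N) I (pairHm1 N) w v := by
  have := isFiniteMeasure_restrict_of_isBounded hIb
  have h := LInfty.tendsto_map (Y := Hm1 N) (L2toHm1 N) hab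
  have h' := @weakStarTendsto_timeDeriv I (H1 N) _ _ _ (H1 N).innerProductSpace rfl hI _ _ w _ h
  exact h' haw (norm_right_le_of_add_le hC)

end Sobolev

end NLS

theorem mainTheorem4 (N : ℕ) (hN : 1 ≤ N)
    (I : Set ℝ) (hI : I.OrdConnected) (hIb : Bornology.IsBounded I)
    (α : ℝ) [hα : Fact (0 < α)] (hcrit : 3 ≤ N → α ≤ 4 / ((N : ℝ) - 2))
    (un : ℕ → NLS.LInfty I (NLS.H1 N)) (u : NLS.LInfty I (NLS.LSp N 2))
    (hbdd : ∃ C : ℝ, ∀ n, ‖un n‖ ≤ C)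
    (hconv : Tendsto (fun n => ‖NLS.LInfty.toL2 I (un n) - u‖) atTop (𝓝 0)) :
    (∃ v : NLS.LInfty I (NLS.H1 N), NLS.LInfty.toL2 I v = u ∧
      NLS.WeakStarTendsto (Y := NLS.Hm1 N) I (NLS.pairH1 N) un v ∧
      NLS.WeakStarTendsto (X := NLS.Hm1 N) I (NLS.pairHm1 N)
        (fun n => NLS.LInfty.laplacian I (un n)) (NLS.LInfty.laplacian I v)) ∧
    (∃ (Gn : ℕ → NLS.LInfty I (NLS.LSp N (NLS.expQ α)))
        (G : NLS.LInfty I (NLS.LSp N (NLS.expQ α))),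
      (∀ n, NLS.IsNonlin I α (NLS.LInfty.toL2 I (un n)) (Gn n)) ∧
      NLS.IsNonlin I α u G ∧
      NLS.WeakStarTendsto I (NLS.lpDuality N (NLS.expQ α) (NLS.expP α)) Gn G) ∧
    (∀ wn : ℕ → NLS.LInfty I (NLS.Hm1 N),
      (∀ n, NLS.IsTimeDeriv I (NLS.LInfty.toHm1 I (NLS.LInfty.toL2 I (un n))) (wn n)) →
      (∃ C : ℝ, ∀ n,
        ‖NLS.LInfty.toHm1 I (NLS.LInfty.toL2 I (un n))‖ + ‖wn n‖ ≤ C) →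
      ∃ w : NLS.LInfty I (NLS.Hm1 N),
        NLS.IsTimeDeriv I (NLS.LInfty.toHm1 I u) w ∧
        NLS.WeakStarTendsto (X := NLS.Hm1 N) I (NLS.pairHm1 N) wn w) := by
  obtain ⟨C, hC⟩ := hbdd
  have hα0 : 0 < α := hα.out
  obtain ⟨v, rfl, hv⟩ := NLS.exists_weakStarTendsto_H1 hIb hC hconv
  obtain ⟨S, hS⟩ := @NLS.SobolevBound.exists_embedding N (α + 2) (by linarith) (NLS.expP_one_le α)
    (NLS.sobolevBound_of_subcritical hN hα0 hcrit)
  refine ⟨⟨v, rfl, hv, NLS.weakStarTendsto_laplacian hv⟩,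
    ⟨fun n => NLS.nonlinLInfty S (un n), NLS.nonlinLInfty S v,
      fun n => NLS.isNonlin_nonlinLInfty S hS (un n), NLS.isNonlin_nonlinLInfty S hS v,
      NLS.weakStarTendsto_nonlinLInfty S hS hC hconv⟩, ?_⟩
  rintro wn hwn ⟨C', hC'⟩
  exact NLS.exists_weakStarTendsto_timeDeriv_toHm1 hI hIb hconv hwn hC'
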